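/- **Definitions.** A process in $C[0,1]$ is a family of random variables $(X_t)_{t\in[0,1]}$ with continuous sample paths. Let $E^-[0,1]$ be the set of bounded functions $f:[0,1]\to(-\infty,0]$ with finitely many discontinuities. A *generator* is a process $Z$ in $C[0,1]$ with $0\le Z_t\le q$ for all $t$, for some constant $q$, and $E(Z_t)=1$ for all $t\in[0,1]$; put $\|f\|_D:=E\big(\sup_{t\in[0,1]}|f(t)|Z_t\big)$. A *copula process* is a process in $C[0,1]$ whose coordinates are all uniformly distributed on $(0,1)$. A copula process $V$ is a *generalized Pareto copula process* (GPCP) if there are a generator $Z$ and $\varepsilon_0>0$ with $P(V\le 1+f)=1-\|f\|_D$ for all $f\in E^-[0,1]$ with $\|f\|_\infty\le\varepsilon_0$ (inequalities between functions are pointwise). A copula process $U$ is in the *$\delta$-neighborhood* of $V$ if for each $f\in E^-[0,1]$ $$P(U\le 1+cf)=P(V\le 1+cf)+O(c^{1+\delta})\qquad (c\downarrow 0).$$ **Statistic.** Let $X=(X_t)_{t\in[0,1]}$ be a process in $C[0,1]$ with identical continuous univariate margins, i.e. $F(x):=P(X_0\le x)=P(X_t\le x)$ for all $t$ and $x$,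 and $F$ is continuous. Let $X^{(1)},X^{(2)},\dots$ be independent copies of $X$, $\hat F_n(x):=n^{-1}\sum_{i=1}^n 1_{(-\infty,x]}(X_0^{(i)})$ and $\hat F_n^{-1}(q):=\inf\{x:\hat F_n(x)\ge q\}$. Fix an integer $k\ge2$ and, for each $n$, a (non-random) set $M(n)\subset\{1,\dots,n\}$ with $m_n$ elements. For $c>0$ and $1\le j\le k$ put $$\hat n_{j}(c):=\sum_{i\in M(n)}1_{(0,1]}\left(\int_0^1 1_{\left(\hat F_n^{-1}(1-c/j),\,\infty\right)}\big(X_t^{(i)}\big)\,dt\right),$$ $$\hat T_n(c):=\frac{\sum_{j=1}^k\left(j\,\hat n_{j}(c)-\frac1k\sum_{\ell=1}^k\ell\,\hat n_{\ell}(c)\right)^2}{\frac1k\sum_{\ell=1}^k\ell\,\hat n_{\ell}(c)},$$ where $\hat T_n(c):=0$ if the denominator vanishes, and, as a convention that concerns only finitely many $n$ below, $\hat F_n^{-1}(1-c/j):=0$ if $n=0$ or $1-c/j\le 0$. **Theorem.** Suppose that the copula process $U=(F(X_t))_{t\in[0,1]}$ is in the $\delta$-neighborhood of a GPCP for some $\delta>0$.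 Let $c_n>0$ and, as $n\to\infty$, $m_n\to\infty$, $m_n\log(m_n)/n\to0$, $c_n\to0$, $m_nc_n\to\infty$ and $m_nc_n^{1+2\delta}\to0$. Then $$\hat T_n(c_n)\to_D\sum_{i=1}^{k-1}\lambda_i\xi_i^2,\qquad \lambda_i=\frac{1}{4\sin^2\left(\frac ik\frac\pi2\right)},$$ in distribution, where $\xi_1,\dots,\xi_{k-1}$ are independent standard normal random variables. -/

import Mathlib

open MeasureTheory ProbabilityTheory Filter Topology

noncomputable section

/-- A stochastic process in `C[0,1]`: every path is continuous and every coordinate is a random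
variable. -/
structure IsContProcess {Ω : Type*} [MeasurableSpace Ω] (X : Ω → unitInterval → ℝ) : Prop where
  continuous_path : ∀ ω, Continuous (X ω)
  measurable_coord : ∀ t, Measurable fun ω => X ω t

/-- The set `E[0,1]` of bounded functions on `[0,1]` with only finitely many discontinuities. -/
def bddFinDiscont : Set (unitInterval → ℝ) :=
  {f | (∃ B : ℝ, ∀ t, |f t| ≤ B) ∧ {t | ¬ ContinuousAt f t}.Finite}

/-- The set `E⁻[0,1]` of those functions in `E[0,1]` that attain only non-positive values. -/
def bddFinDiscontNonpos : Set (unitInterval → ℝ) :=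
  {f | f ∈ bddFinDiscont ∧ ∀ t, f t ≤ 0}

/-- A generator process: a process in `C[0,1]` with `0 ≤ Z_t ≤ q` for some number `q`, and
`E(Z_t) = 1` for each `t`. -/
structure IsGenerator {Ω : Type*} [MeasurableSpace Ω] (Q : Measure Ω)
    (Z : Ω → unitInterval → ℝ) : Prop extends IsContProcess Z where
  nonneg : ∀ ω t, 0 ≤ Z ω t
  bounded : ∃ q : ℝ, ∀ ω t, Z ω t ≤ q
  mean_one : ∀ t, ∫ ω, Z ω t ∂Q = 1

/-- The `D`-norm `‖f‖_D = E (sup_t |f(t)| Z_t)` generated by `Z`. -/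
def dNorm {Ω : Type*} [MeasurableSpace Ω] (Q : Measure Ω) (Z : Ω → unitInterval → ℝ)
    (f : unitInterval → ℝ) : ℝ :=
  ∫ ω, ⨆ t, |f t| * Z ω t ∂Q

/-- A copula process in `C[0,1]`: each coordinate is uniformly distributed on `(0,1)`. -/
structure IsCopulaProcess {Ω : Type*} [MeasurableSpace Ω] (P : Measure Ω)
    (U : Ω → unitInterval → ℝ) : Prop extends IsContProcess U where
  uniform : ∀ t, HasLaw (fun ω => U ω t) (volume.restrict (Set.Ioo (0 : ℝ) 1)) P

/-- `V` is a generalized Pareto copula process whose `D`-norm is the one generated by `Z`. -/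
structure IsGPCP {Ω Ω' : Type*} [MeasurableSpace Ω] [MeasurableSpace Ω'] (P : Measure Ω)
    (V : Ω → unitInterval → ℝ) (Q : Measure Ω') (Z : Ω' → unitInterval → ℝ) : Prop extends
    IsCopulaProcess P V where
  generator : IsGenerator Q Z
  upper_tail : ∃ ε₀ : ℝ, 0 < ε₀ ∧ ∀ f ∈ bddFinDiscontNonpos, (∀ t, |f t| ≤ ε₀) →
    P.real {ω | ∀ t, V ω t ≤ 1 + f t} = 1 - dNorm Q Z f

/-- For each `f ∈ E⁻[0,1]`,
`P(U ≤ 1 + c f) = P'(V ≤ 1 + c f) + O(c ^ (1 + δ))` as `c ↓ 0`. -/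
def InDeltaNeighborhood {Ω Ω' : Type*} [MeasurableSpace Ω] [MeasurableSpace Ω'] (P : Measure Ω)
    (U : Ω → unitInterval → ℝ) (P' : Measure Ω') (V : Ω' → unitInterval → ℝ) (δ : ℝ) : Prop :=
  ∀ f ∈ bddFinDiscontNonpos,
    (fun c : ℝ => P.real {ω | ∀ t, U ω t ≤ 1 + c * f t} - P'.real {ω | ∀ t, V ω t ≤ 1 + c * f t})
      =O[𝓝[>] 0] fun c : ℝ => c ^ (1 + δ)

/-- The distribution function `F(x) = P(X_0 ≤ x)`. -/
def marginDF {Ω : Type*} [MeasurableSpace Ω] (P : Measure Ω) (X : Ω → unitInterval → ℝ)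
    (x : ℝ) : ℝ :=
  P.real {ω | X ω 0 ≤ x}

/-- The process `(F(X_t))_t` with `F` the distribution function of `X_0`. -/
def copulaProcess {Ω : Type*} [MeasurableSpace Ω] (P : Measure Ω) (X : Ω → unitInterval → ℝ)
    (ω : Ω) (t : unitInterval) : ℝ :=
  marginDF P X (X ω t)

/-- The empirical distribution function of the values at time `0` of `x 0, …, x (n - 1)`. -/
def empDF (n : ℕ) (x : ℕ → unitInterval → ℝ) (y : ℝ) : ℝ :=
  (n : ℝ)⁻¹ * ∑ i ∈ Finset.range n, (Set.Iic y).indicator (fun _ => (1 : ℝ)) (x i 0)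

/-- The generalized inverse `H⁻¹(q) = inf {y | H(y) ≥ q}`. -/
def genInv (H : ℝ → ℝ) (q : ℝ) : ℝ :=
  sInf {y | q ≤ H y}

/-- The time that the path `x` spends above the level `γ`. -/
def sojournAbove (x : unitInterval → ℝ) (γ : ℝ) : ℝ :=
  ∫ t, (Set.Ioi γ).indicator (fun _ => (1 : ℝ)) (x t)

/-- The number of `i ∈ M` such that the path `x i` spends a positive time above the empirical
quantile of order `1 - c / j`. -/
def nHat (n : ℕ) (M : Finset ℕ) (x : ℕ → unitInterval → ℝ) (c : ℝ) (j : ℕ) : ℝ :=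
  ∑ i ∈ M, (Set.Ioc (0 : ℝ) 1).indicator (fun _ => (1 : ℝ))
    (sojournAbove (x i) (genInv (empDF n x) (1 - c / j)))

/-- The average `(1/k) ∑ ℓ n̂_ℓ`. -/
def nHatMean (k n : ℕ) (M : Finset ℕ) (x : ℕ → unitInterval → ℝ) (c : ℝ) : ℝ :=
  (1 / (k : ℝ)) * ∑ l ∈ Finset.Icc 1 k, (l : ℝ) * nHat n M x c l

/-- The test statistic `T̂_n(c)` evaluated at the sample `x`. -/
def tHat (k n : ℕ) (M : Finset ℕ) (x : ℕ → unitInterval → ℝ) (c : ℝ) : ℝ :=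
  (∑ j ∈ Finset.Icc 1 k, ((j : ℝ) * nHat n M x c j - nHatMean k n M x c) ^ 2) /
    nHatMean k n M x c

/-- The weight `λ_i = 1 / (4 sin² ((i / k) (π / 2)))`. -/
def limitWeight (k i : ℕ) : ℝ :=
  1 / (4 * Real.sin ((i : ℝ) / k * (Real.pi / 2)) ^ 2)

end

/-! Put D = ‖1‖_D and S² = m c D, and let N_j count the paths with index in `M n` that exceed the
true level F⁻¹(1 - c/j). A continuous path spends positive time above a level as soon as it exceeds
it, and the neighborhood condition with constant f gives the exceedance probability p_j = D c/j +
O(c^(1+δ)) (`exists_exceed_tail_bound`). So j N_j has mean about S² for every j. The exceedance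
events are nested, hence j N_j and l N_l have covariance about j l m p_max(j,l) ≈ S² min(j,l), as
for Brownian motion at integer times. The increments ((j+1) N_(j+1) - j N_j)/S are therefore
asymptotically independent standard normal; the bias vanishes because m c^(1+2δ) → 0
(`tendstoInDistribution_transformedIncr`).

The numerator of the statistic is a quadratic form in these k - 1 increments. The discrete sine
transform diagonalizes it with eigenvalues λ_i (`sum_sq_sub_mean`), and an orthogonal transform
keeps a standard normal vector standard normal. The denominator divided by S² tends to 1 in
probability, so Slutsky's theorem gives the limit.

The empirical levels are harmless: as m/n → 0, each empirical quantile is trapped between two true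
quantiles so close together that only o_P(S) of the counted paths have their maximum between them
(`tendstoInMeasure_nHat_sub_countIn`). -/

noncomputable section

/-! ### Discrete cosine and sine transforms. -/

/-- The orthonormal rows of the discrete cosine transform of order `k`. -/
def cosRow (k i j : ℕ) : ℝ :=
  if i = 0 then √(1 / k) else √(2 / k) * Real.cos ((2 * j + 1) * (i * Real.pi / (2 * k)))

/-- The orthonormal rows of the discrete sine transform of order `k`. -/
def sinRow (k i j : ℕ) : ℝ := √(2 / k) * Real.sin (j * (i * Real.pi / k))

/-- The sum telescopes: 2 cos((2j+1)θ) sin θ = sin((2j+2)θ) - sin(2jθ). -/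
theorem sum_cos_odd_mul (k : ℕ) (θ : ℝ) :
    (∑ j ∈ Finset.range k, Real.cos ((2 * j + 1) * θ)) * (2 * Real.sin θ) =
      Real.sin (2 * k * θ) := by
  induction k with
  | zero => simp
  | succ n ih =>
    rw [Finset.sum_range_succ, add_mul, ih]
    have h1 : Real.sin (2 * ((n + 1 : ℕ) : ℝ) * θ) = Real.sin ((2 * n + 1) * θ + θ) := by
      push_cast; ring_nf
    have h2 : Real.sin (2 * (n : ℝ) * θ) = Real.sin ((2 * n + 1) * θ - θ) := by ring_nf
    rw [h1, h2, Real.sin_add, Real.sin_sub]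
    ring

theorem sum_cos_odd_eq_zero {k r : ℕ} (hr : 0 < r) (hrk : r < 2 * k) :
    ∑ j ∈ Finset.range k, Real.cos ((2 * j + 1) * (r * Real.pi / (2 * k))) = 0 := by
  have hk : (0 : ℝ) < 2 * k := by exact_mod_cast (by omega : 0 < 2 * k)
  have h := sum_cos_odd_mul k (r * Real.pi / (2 * k))
  have h1 : 2 * (k : ℝ) * (r * Real.pi / (2 * k)) = r * Real.pi :=
    mul_div_cancel₀ _ hk.ne'
  rw [h1, Real.sin_nat_mul_pi] at h
  have hs : 0 < Real.sin (r * Real.pi / (2 * k)) := by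
    apply Real.sin_pos_of_pos_of_lt_pi
    · have : (0 : ℝ) < r := by exact_mod_cast hr
      positivity
    · rw [div_lt_iff₀ hk, mul_comm]
      have : (r : ℝ) < 2 * k := by exact_mod_cast hrk
      exact mul_lt_mul_of_pos_left this Real.pi_pos
  rcases mul_eq_zero.1 h with h | h
  · exact h
  · linarith

theorem sum_cos_mul_cos {k i l : ℕ} (hi : 0 < i) (hik : i < k) (hl : 0 < l) (hlk : l < k) :
    ∑ j ∈ Finset.range k, Real.cos ((2 * j + 1) * (i * Real.pi / (2 * k))) *
      Real.cos ((2 * j + 1) * (l * Real.pi / (2 * k))) = if i = l then (k : ℝ) / 2 else 0 := by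
  -- The product-to-sum formula produces the frequencies i + l and i - l; the order makes the second
  -- a natural number.
  wlog hil : l ≤ i generalizing i l
  · have := this hl hlk hi hik (by omega)
    simp_rw [mul_comm, eq_comm (a := i)] at this ⊢
    exact this
  have hprod : ∀ a b : ℝ, Real.cos a * Real.cos b = (Real.cos (a - b) + Real.cos (a + b)) / 2 := by
    intro a b; rw [Real.cos_sub, Real.cos_add]; ring
  simp_rw [hprod]
  rw [← Finset.sum_div, Finset.sum_add_distrib]
  have h1 : ∀ j : ℕ, (2 * (j : ℝ) + 1) * (i * Real.pi / (2 * k)) +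
      (2 * j + 1) * (l * Real.pi / (2 * k)) =
      (2 * j + 1) * ((i + l : ℕ) * Real.pi / (2 * k)) := by intro j; push_cast; ring
  have h2 : ∀ j : ℕ, (2 * (j : ℝ) + 1) * (i * Real.pi / (2 * k)) -
      (2 * j + 1) * (l * Real.pi / (2 * k)) =
      (2 * j + 1) * ((i - l : ℕ) * Real.pi / (2 * k)) := by
    intro j; rw [Nat.cast_sub hil]; ring
  simp_rw [h1, h2]
  rw [sum_cos_odd_eq_zero (r := i + l) (by omega) (by omega)]
  split_ifs with h
  · subst h; simp
  · rw [sum_cos_odd_eq_zero (r := i - l) (by omega) (by omega)]; simp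

theorem sum_cosRow_mul_cosRow {k i l : ℕ} (hik : i < k) (hlk : l < k) :
    ∑ j ∈ Finset.range k, cosRow k i j * cosRow k l j = if i = l then 1 else 0 := by
  have hk : (0 : ℝ) < k := by exact_mod_cast (by omega : 0 < k)
  rcases Nat.eq_zero_or_pos i with hi | hi <;> rcases Nat.eq_zero_or_pos l with hl | hl
  · subst hi hl
    simp only [cosRow, if_true, Finset.sum_const, Finset.card_range, nsmul_eq_mul]
    rw [Real.mul_self_sqrt (by positivity)]
    field_simp
  · subst hi
    simp only [cosRow, if_true, if_neg hl.ne', if_neg hl.ne]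
    rw [← Finset.mul_sum, ← Finset.mul_sum, sum_cos_odd_eq_zero hl (by omega)]
    simp
  · subst hl
    simp only [cosRow, if_true, if_neg hi.ne']
    rw [← Finset.sum_mul, ← Finset.mul_sum, sum_cos_odd_eq_zero hi (by omega)]
    simp
  · simp only [cosRow, if_neg hi.ne', if_neg hl.ne']
    have : ∀ j ∈ Finset.range k,
        √(2 / (k : ℝ)) * Real.cos ((2 * j + 1) * (i * Real.pi / (2 * k))) *
        (√(2 / (k : ℝ)) * Real.cos ((2 * j + 1) * (l * Real.pi / (2 * k)))) =
        2 / k * (Real.cos ((2 * j + 1) * (i * Real.pi / (2 * k))) *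
          Real.cos ((2 * j + 1) * (l * Real.pi / (2 * k)))) := by
      intro j _
      rw [mul_mul_mul_comm, Real.mul_self_sqrt (by positivity)]
    rw [Finset.sum_congr rfl this, ← Finset.mul_sum, sum_cos_mul_cos hi hik hl hlk]
    split_ifs
    · field_simp
    · simp

/-- Parseval's identity for the discrete cosine transform. -/
theorem sum_sq_sum_cosRow_mul (k : ℕ) (w : ℕ → ℝ) :
    ∑ i ∈ Finset.range k, (∑ j ∈ Finset.range k, cosRow k i j * w j) ^ 2 =
      ∑ j ∈ Finset.range k, w j ^ 2 := by
  let E : Matrix (Fin k) (Fin k) ℝ := fun i j => cosRow k i j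
  have hE : E * E.transpose = 1 := by
    ext i l
    rw [Matrix.mul_apply]
    change ∑ j : Fin k, cosRow k i j * cosRow k l j = _
    rw [Fin.sum_univ_eq_sum_range (fun j => cosRow k i j * cosRow k l j),
      sum_cosRow_mul_cosRow i.2 l.2, Matrix.one_apply]
    simp [Fin.ext_iff]
  -- For a square matrix, orthonormal rows force orthonormal columns, so the transform is an
  -- isometry.
  have hE' : E.transpose * E = 1 := mul_eq_one_comm.1 hE
  let v : Fin k → ℝ := fun j => w j
  have h : (E.mulVec v) ⬝ᵥ (E.mulVec v) = v ⬝ᵥ v := by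
    rw [Matrix.dotProduct_mulVec, Matrix.vecMul_mulVec, ← Matrix.dotProduct_mulVec, hE',
      Matrix.one_mulVec]
  rw [← Fin.sum_univ_eq_sum_range (fun j => w j ^ 2),
    ← Fin.sum_univ_eq_sum_range (fun i => (∑ j ∈ Finset.range k, cosRow k i j * w j) ^ 2)]
  simp only [dotProduct, Matrix.mulVec, v, E] at h
  simp_rw [pow_two]
  rw [← h]
  refine Finset.sum_congr rfl fun i _ => ?_
  rw [Fin.sum_univ_eq_sum_range (fun j => cosRow k i j * w j)]

/-- The discrete derivative maps sine rows to multiples of cosine rows; the factor is λ_i^(-1/2),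
which is where the weights come from. -/
theorem sinRow_succ_sub {k i : ℕ} (hi : 0 < i) (j : ℕ) :
    sinRow k i (j + 1) - sinRow k i j =
      2 * Real.sin (i / k * (Real.pi / 2)) * cosRow k i j := by
  rw [sinRow, sinRow, cosRow, if_neg hi.ne', ← mul_sub, Real.sin_sub_sin]
  have h1 : (((j + 1 : ℕ) : ℝ) * (i * Real.pi / k) - j * (i * Real.pi / k)) / 2 =
    i / k * (Real.pi / 2) := by push_cast; ring
  have h2 : (((j + 1 : ℕ) : ℝ) * (i * Real.pi / k) + j * (i * Real.pi / k)) / 2 =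
    (2 * j + 1) * (i * Real.pi / (2 * k)) := by push_cast; ring
  rw [h1, h2]
  ring

/-- Summation by parts; both boundary terms vanish because the sine row is zero at 0 and at k. -/
theorem sum_sinRow_mul_sub {k i : ℕ} (hi : 0 < i) (hk : 0 < k) (w : ℕ → ℝ) :
    ∑ j ∈ Finset.range (k - 1), sinRow k i (j + 1) * (w (j + 1) - w j) =
      -(2 * Real.sin (i / k * (Real.pi / 2)) *
        ∑ j ∈ Finset.range k, cosRow k i j * w j) := by
  have key : ∀ K : ℕ, ∑ j ∈ Finset.range K, sinRow k i (j + 1) * (w (j + 1) - w j) =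
      sinRow k i (K + 1) * w K -
      2 * Real.sin (i / k * (Real.pi / 2)) *
        ∑ j ∈ Finset.range (K + 1), cosRow k i j * w j := by
    intro K
    induction K with
    | zero =>
      have := sinRow_succ_sub (k := k) hi 0
      have h0 : sinRow k i 0 = 0 := by simp [sinRow]
      simp only [Finset.range_zero, Finset.sum_empty, zero_add, Finset.range_one,
        Finset.sum_singleton] at this ⊢
      linear_combination -w 0 * this - w 0 * h0
    | succ K ih =>
      rw [Finset.sum_range_succ, ih, Finset.sum_range_succ _ (K + 1)]
      linear_combination -w (K + 1) * sinRow_succ_sub (k := k) hi (K + 1)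
  rw [key, Nat.sub_add_cancel hk]
  have : sinRow k i k = 0 := by
    have hk' : (k : ℝ) ≠ 0 := by exact_mod_cast hk.ne'
    rw [sinRow, mul_div_cancel₀ _ hk', Real.sin_nat_mul_pi, mul_zero]
  rw [this]; ring

theorem sin_half_angle_pos {k i : ℕ} (hi : 0 < i) (hik : i < k) :
    0 < Real.sin ((i : ℝ) / k * (Real.pi / 2)) := by
  have hi' : (0 : ℝ) < i := by exact_mod_cast hi
  have hk : (0 : ℝ) < k := by exact_mod_cast (by omega : 0 < k)
  apply Real.sin_pos_of_pos_of_lt_pi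
  · have := Real.pi_pos
    positivity
  · have : (i : ℝ) / k < 1 := by rw [div_lt_one hk]; exact_mod_cast hik
    nlinarith [Real.pi_pos]

/-- The centred sum of squares as a weighted sum of squares of sine-transformed increments. -/
theorem sum_sq_sub_mean (k : ℕ) (hk : 0 < k) (w : ℕ → ℝ) :
    ∑ j ∈ Finset.range k, (w j - 1 / k * ∑ l ∈ Finset.range k, w l) ^ 2 =
      ∑ i ∈ Finset.range (k - 1), limitWeight k (i + 1) *
        (∑ j ∈ Finset.range (k - 1), sinRow k (i + 1) (j + 1) * (w (j + 1) - w j)) ^ 2 := by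
  have hk' : (k : ℝ) ≠ 0 := by exact_mod_cast hk.ne'
  have hP := sum_sq_sum_cosRow_mul k w
  obtain ⟨K, rfl⟩ : ∃ K, k = K + 1 := ⟨k - 1, by omega⟩
  rw [Finset.sum_range_succ'] at hP
  -- The cosine coefficient of index 0 carries exactly the mean, so centring removes it from
  -- Parseval's identity.
  have h0 : (∑ j ∈ Finset.range (K + 1), cosRow (K + 1) 0 j * w j) ^ 2 =
      1 / ((K + 1 : ℕ) : ℝ) * (∑ l ∈ Finset.range (K + 1), w l) ^ 2 := by
    simp only [cosRow, if_true]
    rw [← Finset.mul_sum, mul_pow, Real.sq_sqrt (by positivity)]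
  rw [h0] at hP
  have hL : ∑ j ∈ Finset.range (K + 1),
      (w j - 1 / ((K + 1 : ℕ) : ℝ) * ∑ l ∈ Finset.range (K + 1), w l) ^ 2 =
      ∑ j ∈ Finset.range (K + 1), w j ^ 2 -
      1 / ((K + 1 : ℕ) : ℝ) * (∑ l ∈ Finset.range (K + 1), w l) ^ 2 := by
    simp_rw [sub_sq]
    rw [Finset.sum_add_distrib, Finset.sum_sub_distrib, Finset.sum_const, Finset.card_range,
      nsmul_eq_mul, ← Finset.sum_mul, ← Finset.mul_sum]
    field_simp
    ring
  rw [hL, ← hP, add_sub_cancel_right, Nat.add_sub_cancel]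
  refine Finset.sum_congr rfl fun i hi => ?_
  have hs := sin_half_angle_pos (k := K + 1) (i := i + 1) (by omega)
    (by have := Finset.mem_range.1 hi; omega)
  have hS := sum_sinRow_mul_sub (k := K + 1) (i := i + 1) (by omega) (by omega) w
  rw [Nat.add_sub_cancel] at hS
  rw [hS, limitWeight, neg_sq, mul_pow, mul_pow, ← mul_assoc, one_div]
  have hs' := hs.ne'
  generalize Real.sin (((i + 1 : ℕ) : ℝ) / ((K + 1 : ℕ) : ℝ) * (Real.pi / 2)) = x at hs'
  field_simp
  ring

/-- A sine row is, up to a factor, the discrete derivative of a cosine row, so summation by parts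
reduces the claim to orthonormality of the cosine rows. -/
theorem sum_sinRow_mul_sinRow {k i l : ℕ} (hi : 0 < i) (hik : i < k) (hl : 0 < l) (hlk : l < k) :
    ∑ j ∈ Finset.range (k - 1), sinRow k i (j + 1) * sinRow k l (j + 1) =
      if i = l then 1 else 0 := by
  have hs := sin_half_angle_pos hl hlk
  have hsi := sin_half_angle_pos hi hik
  have hk : 0 < k := by omega
  have hd : ∀ j, sinRow k l (j + 1) =
      -(cosRow k l (j + 1) - cosRow k l j) / (2 * Real.sin (l / k * (Real.pi / 2))) := by
    intro j
    rw [eq_div_iff (by positivity)]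
    simp only [sinRow, cosRow, if_neg hl.ne']
    rw [← mul_sub, Real.cos_sub_cos]
    have h1 : (((2 * ((j + 1 : ℕ) : ℝ) + 1) * (l * Real.pi / (2 * k))) +
      (2 * j + 1) * (l * Real.pi / (2 * k))) / 2 = (j + 1 : ℕ) * (l * Real.pi / k) := by
      push_cast; field_simp; ring
    have h2 : (((2 * ((j + 1 : ℕ) : ℝ) + 1) * (l * Real.pi / (2 * k))) -
      (2 * j + 1) * (l * Real.pi / (2 * k))) / 2 = l / k * (Real.pi / 2) := by
      push_cast; field_simp; ring
    rw [h1, h2]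
    ring
  simp_rw [hd]
  have hS := sum_sinRow_mul_sub hi hk (fun j => cosRow k l j)
  rw [sum_cosRow_mul_cosRow hik hlk] at hS
  have : ∀ j, sinRow k i (j + 1) * (-(cosRow k l (j + 1) - cosRow k l j) /
      (2 * Real.sin (l / k * (Real.pi / 2)))) =
      -(1 / (2 * Real.sin (l / k * (Real.pi / 2)))) *
      (sinRow k i (j + 1) * (cosRow k l (j + 1) - cosRow k l j)) := by intro j; ring
  simp_rw [this]
  rw [← Finset.mul_sum, hS]
  split_ifs with h
  · subst h
    have hs' := hs.ne'
    generalize Real.sin ((i : ℝ) / k * (Real.pi / 2)) = x at hs'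
    field_simp
  · simp

/-- Identifies the limit variance of the projection of the transformed increments on `s`. -/
theorem sum_sq_sum_sinRow (k : ℕ) (s : Fin (k - 1) → ℝ) :
    ∑ j ∈ Finset.range (k - 1), (∑ i : Fin (k - 1), s i * sinRow k (i + 1) (j + 1)) ^ 2 =
      ∑ i, s i ^ 2 := by
  simp_rw [pow_two, Finset.sum_mul_sum]
  rw [Finset.sum_comm]
  refine Finset.sum_congr rfl fun i _ => ?_
  rw [Finset.sum_comm]
  have : ∀ l : Fin (k - 1), ∑ j ∈ Finset.range (k - 1), s i * sinRow k (i + 1) (j + 1) *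
      (s l * sinRow k (l + 1) (j + 1)) = if i = l then s i * s l else 0 := by
    intro l
    have h := sum_sinRow_mul_sinRow (k := k) (i := i + 1) (l := l + 1) (by omega) (by omega)
      (by omega) (by omega)
    have h' : ∀ j, s i * sinRow k (i + 1) (j + 1) * (s l * sinRow k (l + 1) (j + 1)) =
      s i * s l * (sinRow k (i + 1) (j + 1) * sinRow k (l + 1) (j + 1)) := by intro j; ring
    simp_rw [h', ← Finset.mul_sum, h]
    simp [Fin.ext_iff]
  simp_rw [this]
  simp

/-! ### A central limit theorem for bounded triangular arrays. -/

theorem norm_pow_sub_pow_le_mul {x y : ℂ} (hx : ‖x‖ ≤ 1) (hy : ‖y‖ ≤ 1) (n : ℕ) :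
    ‖x ^ n - y ^ n‖ ≤ n * ‖x - y‖ := by
  induction n with
  | zero => simp
  | succ n ih =>
    have h : x ^ (n + 1) - y ^ (n + 1) = x ^ n * (x - y) + (x ^ n - y ^ n) * y := by ring
    rw [h]
    have h1 : ‖x ^ n * (x - y)‖ ≤ 1 * ‖x - y‖ := by
      rw [norm_mul, norm_pow]
      exact mul_le_mul_of_nonneg_right (pow_le_one₀ (norm_nonneg _) hx) (norm_nonneg _)
    have h2 : ‖(x ^ n - y ^ n) * y‖ ≤ n * ‖x - y‖ * 1 := by
      rw [norm_mul]
      exact mul_le_mul ih hy (norm_nonneg _) (by positivity)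
    refine (norm_add_le _ _).trans ?_
    push_cast
    linarith

/-- If `m (a - 1) → -v / 2` with `a` in the unit disc and `m → ∞`, then `a ^ m → exp (-v / 2)`. -/
theorem tendsto_pow_exp_neg_half {m : ℕ → ℕ} (hm : Tendsto m atTop atTop) {a : ℕ → ℂ}
    (ha : ∀ n, ‖a n‖ ≤ 1) {v : ℝ}
    (hv : 0 ≤ v) (h : Tendsto (fun n => (m n : ℂ) * (a n - 1)) atTop (𝓝 (-(v / 2 : ℝ)))) :
    Tendsto (fun n => a n ^ m n) atTop (𝓝 (Complex.exp (-(v / 2 : ℝ)))) := by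
  -- Since `y n ^ m n` is eventually the limit itself, it suffices that m |a - y| → 0; both bases
  -- agree with 1 - v/(2m) up to o(1/m).
  set y : ℕ → ℂ := fun n => Complex.exp (-(v / 2 : ℝ) / m n)
  have hm' : Tendsto (fun n => (m n : ℝ)) atTop atTop :=
    tendsto_natCast_atTop_atTop.comp hm
  have hy : ∀ n, ‖y n‖ ≤ 1 := by
    intro n
    have : (-(v / 2 : ℝ) / m n : ℂ) = ((-(v / 2) / m n : ℝ) : ℂ) := by push_cast; ring
    simp only [y]
    rw [this, Complex.norm_exp_ofReal, Real.exp_le_one_iff]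
    exact div_nonpos_of_nonpos_of_nonneg (by linarith) (Nat.cast_nonneg _)
  have hyp : ∀ᶠ n in atTop, y n ^ m n = Complex.exp (-(v / 2 : ℝ)) := by
    filter_upwards [hm.eventually_gt_atTop 0] with n hn
    have : (m n : ℂ) ≠ 0 := by exact_mod_cast hn.ne'
    rw [← Complex.exp_nat_mul, mul_div_cancel₀ _ this]
  have hyl : Tendsto (fun n => (m n : ℝ) * ‖y n - 1 - -(v / 2 : ℝ) / m n‖) atTop (𝓝 0) := by
    have hbound : Tendsto (fun n => (v / 2) ^ 2 / (m n : ℝ)) atTop (𝓝 0) :=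
      hm'.const_div_atTop _
    refine squeeze_zero' (Eventually.of_forall fun n => by positivity) ?_ hbound
    filter_upwards [hm'.eventually_gt_atTop 0, hm'.eventually_ge_atTop (v / 2)] with n hn hn2
    have hnorm : ‖(-(v / 2 : ℝ) / m n : ℂ)‖ = v / 2 / m n := by
      rw [norm_div, norm_neg, Complex.norm_real, Complex.norm_natCast, Real.norm_of_nonneg
        (by positivity)]
    have h1 : ‖(-(v / 2 : ℝ) / m n : ℂ)‖ ≤ 1 := by
      rw [hnorm, div_le_one hn]; exact hn2
    have h2 := Complex.norm_exp_sub_one_sub_id_le h1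
    rw [hnorm] at h2
    calc (m n : ℝ) * _ ≤ m n * (v / 2 / m n) ^ 2 := mul_le_mul_of_nonneg_left h2 hn.le
      _ = (v / 2) ^ 2 / m n := by field_simp
  have hal : Tendsto (fun n => ‖(m n : ℂ) * (a n - 1) - -(v / 2 : ℝ)‖) atTop (𝓝 0) :=
    tendsto_iff_norm_sub_tendsto_zero.1 h
  rw [tendsto_iff_norm_sub_tendsto_zero]
  refine squeeze_zero' (Eventually.of_forall fun n => norm_nonneg _) ?_
    (by have := hal.add hyl; rwa [add_zero] at this)
  filter_upwards [hyp, hm.eventually_gt_atTop 0] with n hn hn0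
  have hm0 : (m n : ℂ) ≠ 0 := by exact_mod_cast hn0.ne'
  rw [← hn]
  refine (norm_pow_sub_pow_le_mul (ha n) (hy n) _).trans ?_
  have : a n - y n = ((a n - 1) - -(v / 2 : ℝ) / m n) - (y n - 1 - -(v / 2 : ℝ) / m n) := by ring
  rw [this]
  have h3 : (m n : ℝ) * ‖(a n - 1) - -(v / 2 : ℝ) / m n‖ =
      ‖(m n : ℂ) * (a n - 1) - -(v / 2 : ℝ)‖ := by
    rw [← Complex.norm_natCast, ← norm_mul, mul_sub, mul_div_cancel₀ _ hm0]
  rw [← h3, ← mul_add]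
  exact mul_le_mul_of_nonneg_left (norm_sub_le _ _) (Nat.cast_nonneg _)

/-- In the form |y| y² the first factor can be bounded uniformly while the second integrates to a
second moment. -/
theorem norm_exp_mul_I_sub_taylor_two_le {y : ℝ} (hy : |y| ≤ 1) :
    ‖Complex.exp (y * Complex.I) - (1 + y * Complex.I - (y ^ 2 / 2 : ℝ))‖ ≤ |y| * y ^ 2 := by
  have h1 : ‖(y * Complex.I : ℂ)‖ = |y| := by simp
  have h := Complex.exp_bound (x := y * Complex.I) (by rw [h1]; exact hy) (n := 3) (by norm_num)
  rw [h1] at h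
  have h2 : ∑ m ∈ Finset.range 3, (y * Complex.I : ℂ) ^ m / m.factorial =
      1 + y * Complex.I - (y ^ 2 / 2 : ℝ) := by
    simp only [Finset.sum_range_succ, Finset.range_zero, Finset.sum_empty, Nat.factorial]
    push_cast
    linear_combination (y ^ 2 / 2 : ℂ) * Complex.I_sq
  rw [h2] at h
  refine h.trans ?_
  have h3 : |y| ^ 3 = |y| * y ^ 2 := by rw [← sq_abs]; ring
  rw [h3]
  refine mul_le_of_le_one_right (by positivity) ?_
  norm_num [Nat.factorial]

variable {Ω 𝒳 : Type*} [MeasurableSpace Ω] [MeasurableSpace 𝒳]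

/-- Characteristic functions of row sums of a bounded, row-wise i.i.d. triangular array. -/
theorem tendsto_charFun_sum_of_bounded {P : Measure Ω} [IsProbabilityMeasure P] {μ : Measure 𝒳}
    [IsProbabilityMeasure μ] {W : ℕ → Ω → 𝒳} (hW : iIndepFun W P) (hlaw : ∀ i, HasLaw (W i) μ P)
    {M : ℕ → Finset ℕ} (hm : Tendsto (fun n => (M n).card) atTop atTop) {Y : ℕ → 𝒳 → ℝ}
    (hY : ∀ n, Measurable (Y n)) {b : ℕ → ℝ} (hb : Tendsto b atTop (𝓝 0))
    (hYb : ∀ n x, |Y n x| ≤ b n) {v : ℝ}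
    (h1 : Tendsto (fun n => ((M n).card : ℝ) * ∫ x, Y n x ∂μ) atTop (𝓝 0))
    (h2 : Tendsto (fun n => ((M n).card : ℝ) * ∫ x, Y n x ^ 2 ∂μ) atTop (𝓝 v)) :
    Tendsto (fun n => ∫ ω, Complex.exp ((∑ i ∈ M n, Y n (W i ω) : ℝ) * Complex.I) ∂P) atTop
      (𝓝 (Complex.exp (-(v / 2 : ℝ)))) := by
  have hv : 0 ≤ v := ge_of_tendsto' h2 fun n =>
    mul_nonneg (Nat.cast_nonneg _) (integral_nonneg fun x => sq_nonneg _)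
  have hmap : ∀ n i, P.map (fun ω => Y n (W i ω)) = μ.map (Y n) := by
    intro n i
    rw [← (hlaw i).map_eq, AEMeasurable.map_map_of_aemeasurable (hY n).aemeasurable
      (hlaw i).aemeasurable]
    rfl
  have hYm : ∀ n i, AEMeasurable (fun ω => Y n (W i ω)) P := fun n i =>
    (hY n).comp_aemeasurable (hlaw i).aemeasurable
  have hprod : ∀ n, ∫ ω, Complex.exp ((∑ i ∈ M n, Y n (W i ω) : ℝ) * Complex.I) ∂P =
      charFun (μ.map (Y n)) 1 ^ (M n).card := by
    intro n
    have hind : iIndepFun (fun i ω => Y n (W i ω)) P := hW.comp (fun _ => Y n) fun _ => hY n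
    have := (hind.restrict (M n)).charFun_map_fun_finsetSum_eq_prod (fun i _ => hYm n i)
    have h' := congrFun this 1
    simp only [hmap, Finset.prod_const, Pi.pow_apply] at h'
    rw [← h', charFun_apply_real, integral_map
      (Finset.aemeasurable_fun_sum _ fun i _ => hYm n i) (by fun_prop)]
    simp
  simp_rw [hprod]
  have : ∀ n, IsProbabilityMeasure (μ.map (Y n)) := fun n =>
    Measure.isProbabilityMeasure_map (hY n).aemeasurable
  refine tendsto_pow_exp_neg_half hm (fun n => norm_charFun_le_one _) hv ?_
  have hYi : ∀ n, Integrable (Y n) μ := fun n =>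
    Integrable.of_bound (hY n).aestronglyMeasurable (b n)
      (Eventually.of_forall fun x => hYb n x)
  have hYi2 : ∀ n, Integrable (fun x => Y n x ^ 2) μ := fun n =>
    Integrable.of_bound ((hY n).pow_const 2).aestronglyMeasurable (b n ^ 2)
      (Eventually.of_forall fun x => by
        rw [Real.norm_of_nonneg (sq_nonneg _), ← sq_abs]
        exact pow_le_pow_left₀ (abs_nonneg _) (hYb n x) 2)
  have hE : ∀ n, charFun (μ.map (Y n)) 1 = ∫ x, Complex.exp (Y n x * Complex.I) ∂μ := by
    intro n
    rw [charFun_apply_real, integral_map (hY n).aemeasurable (by fun_prop)]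
    simp
  have hexp : ∀ n, Integrable (fun x => Complex.exp (Y n x * Complex.I)) μ := fun n =>
    Integrable.of_bound (by have := hY n; fun_prop) 1
      (Eventually.of_forall fun x => (Complex.norm_exp_ofReal_mul_I _).le)
  set r : ℕ → ℂ := fun n => ∫ x, (Complex.exp (Y n x * Complex.I) -
    (1 + Y n x * Complex.I - (Y n x ^ 2 / 2 : ℝ))) ∂μ with hr
  have hYc : ∀ n, Integrable (fun x => (Y n x : ℂ) * Complex.I) μ := fun n =>
    (hYi n).ofReal.mul_const _
  have hYc2 : ∀ n, Integrable (fun x => ((Y n x ^ 2 / 2 : ℝ) : ℂ)) μ := fun n =>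
    ((hYi2 n).div_const 2).ofReal
  have hdec : ∀ n, charFun (μ.map (Y n)) 1 - 1 =
      ((∫ x, Y n x ∂μ : ℝ) : ℂ) * Complex.I - ((∫ x, Y n x ^ 2 ∂μ) / 2 : ℝ) + r n := by
    intro n
    have : r n = ∫ x, Complex.exp (Y n x * Complex.I) ∂μ -
        (1 + ((∫ x, Y n x ∂μ : ℝ) : ℂ) * Complex.I - ((∫ x, Y n x ^ 2 ∂μ) / 2 : ℝ)) := by
      simp only [hr]
      have hlin : Integrable (fun x => 1 + (Y n x : ℂ) * Complex.I) μ :=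
        (integrable_const 1).add (hYc n)
      have hquad : Integrable (fun x => 1 + (Y n x : ℂ) * Complex.I - (Y n x ^ 2 / 2 : ℝ)) μ :=
        hlin.sub (hYc2 n)
      rw [integral_sub (hexp n) hquad, integral_sub hlin (hYc2 n),
        integral_add (integrable_const 1) (hYc n), integral_mul_const, integral_complex_ofReal,
        integral_complex_ofReal, integral_div]
      simp
    rw [this, hE]
    ring
  -- The uniform bound plays the role of Lindeberg's condition: m |r| ≤ b · m E(Y²) with b → 0.
  have hrb : Tendsto (fun n => ((M n).card : ℂ) * r n) atTop (𝓝 0) := by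
    have hlim : Tendsto (fun n => b n * (((M n).card : ℝ) * ∫ x, Y n x ^ 2 ∂μ)) atTop (𝓝 0) := by
      simpa using hb.mul h2
    refine squeeze_zero_norm' ?_ hlim
    filter_upwards [hb.eventually_le_const one_pos] with n hn
    have hle : ‖r n‖ ≤ ∫ x, b n * Y n x ^ 2 ∂μ := by
      refine norm_integral_le_of_norm_le ((hYi2 n).const_mul _) (Eventually.of_forall fun x => ?_)
      refine (norm_exp_mul_I_sub_taylor_two_le ((hYb n x).trans hn)).trans ?_
      exact mul_le_mul_of_nonneg_right (hYb n x) (sq_nonneg _)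
    rw [integral_const_mul] at hle
    rw [norm_mul, Complex.norm_natCast]
    calc _ ≤ ((M n).card : ℝ) * (b n * ∫ x, Y n x ^ 2 ∂μ) :=
          mul_le_mul_of_nonneg_left hle (Nat.cast_nonneg _)
      _ = _ := by ring
  have h1' := ((Complex.continuous_ofReal.tendsto _).comp h1).mul_const Complex.I
  have h2' := (Complex.continuous_ofReal.tendsto _).comp (h2.div_const 2)
  have := (h1'.sub h2').add hrb
  simp only [Complex.ofReal_zero, zero_mul, zero_sub, add_zero] at this
  refine this.congr fun n => ?_
  rw [hdec]
  simp only [Function.comp]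
  push_cast
  ring

theorem charFun_toLp_of_iIndepFun_gaussian {ι : Type*} [Fintype ι] {P : Measure Ω}
    [IsProbabilityMeasure P] {ξ : ι → Ω → ℝ} (hξ : ∀ i, HasLaw (ξ i) (gaussianReal 0 1) P)
    (hind : iIndepFun ξ P) (t : EuclideanSpace ℝ ι) :
    charFun (P.map fun ω => WithLp.toLp 2 fun i => ξ i ω) t =
      Complex.exp (-((∑ i, t i ^ 2) / 2 : ℝ)) := by
  rw [(iIndepFun_iff_charFun_pi fun i => (hξ i).aemeasurable).1 hind t]
  simp_rw [(hξ _).map_eq, charFun_gaussianReal]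
  rw [← Complex.exp_sum]
  congr 1
  push_cast
  simp [Finset.sum_div]

/-- Convergence in distribution to a standard normal vector by one-dimensional projections. -/
theorem tendstoInDistribution_toLp_of_tendsto {ι Ω' : Type*} [Fintype ι] [MeasurableSpace Ω']
    {P : Measure Ω} [IsProbabilityMeasure P] {P' : Measure Ω'} [IsProbabilityMeasure P']
    {ξ : ι → Ω' → ℝ} (hξ : ∀ i, HasLaw (ξ i) (gaussianReal 0 1) P') (hind : iIndepFun ξ P')
    {η : ℕ → ι → Ω → ℝ} (hη : ∀ n i, AEMeasurable (η n i) P)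
    (h : ∀ s : ι → ℝ, Tendsto (fun n => ∫ ω, Complex.exp ((∑ i, s i * η n i ω : ℝ) * Complex.I) ∂P)
      atTop (𝓝 (Complex.exp (-((∑ i, s i ^ 2) / 2 : ℝ))))) :
    TendstoInDistribution (fun n ω => WithLp.toLp 2 fun i => η n i ω) atTop
      (fun ω => WithLp.toLp 2 fun i => ξ i ω) (fun _ => P) P' where
  forall_aemeasurable n := (WithLp.measurable_toLp 2 _).comp_aemeasurable
    (aemeasurable_pi_lambda _ fun i => hη n i)
  aemeasurable_limit := (WithLp.measurable_toLp 2 _).comp_aemeasurable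
    (aemeasurable_pi_lambda _ fun i => (hξ i).aemeasurable)
  tendsto := by
    refine ProbabilityMeasure.tendsto_iff_tendsto_charFun.2 fun t => ?_
    simp only [ProbabilityMeasure.coe_mk]
    rw [charFun_toLp_of_iIndepFun_gaussian hξ hind]
    refine (h fun i => t i).congr fun n => ?_
    have hf : AEMeasurable (fun ω => WithLp.toLp 2 fun i => η n i ω) P :=
      (WithLp.measurable_toLp 2 _).comp_aemeasurable (aemeasurable_pi_lambda _ fun i => hη n i)
    rw [charFun_apply, integral_map hf (by fun_prop)]
    simp [PiLp.inner_apply]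

/-! ### Moment bounds for counts. -/

/-- The number of indices `i ∈ s` with `w i ∈ A`. -/
def countIn {𝒳 : Type*} (s : Finset ℕ) (A : Set 𝒳) (w : ℕ → 𝒳) : ℝ :=
  ∑ i ∈ s, A.indicator (fun _ => (1 : ℝ)) (w i)

section CountIn

variable {Ω 𝒳 : Type*} [MeasurableSpace Ω] [MeasurableSpace 𝒳] {P : Measure Ω}
  {μ : Measure 𝒳} {W : ℕ → Ω → 𝒳}

theorem measurable_countIn (hW : ∀ i, Measurable (W i)) (s : Finset ℕ) {A : Set 𝒳}
    (hA : MeasurableSet A) : Measurable fun ω => countIn s A fun i => W i ω :=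
  Finset.measurable_fun_sum _ fun i _ => (measurable_const.indicator hA).comp (hW i)

theorem abs_indicator_one_le {α : Type*} (A : Set α) (x : α) :
    |A.indicator (fun _ => (1 : ℝ)) x| ≤ 1 := by
  by_cases h : x ∈ A <;> simp [h]

theorem memLp_indicator_one_comp [IsProbabilityMeasure P] (hlaw : ∀ i, HasLaw (W i) μ P) {A : Set 𝒳}
    (hA : MeasurableSet A) (i : ℕ) {p : ENNReal} :
    MemLp (fun ω => A.indicator (fun _ => (1 : ℝ)) (W i ω)) p P :=
  MemLp.of_bound ((measurable_const.indicator hA).comp_aemeasurable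
    (hlaw i).aemeasurable).aestronglyMeasurable 1
    (Eventually.of_forall fun _ => abs_indicator_one_le _ _)

theorem integral_indicator_one_comp (hlaw : ∀ i, HasLaw (W i) μ P) {A : Set 𝒳}
    (hA : MeasurableSet A) (i : ℕ) :
    ∫ ω, A.indicator (fun _ => (1 : ℝ)) (W i ω) ∂P = μ.real A := by
  rw [← integral_map (hlaw i).aemeasurable (f := A.indicator fun _ => (1 : ℝ))
    (measurable_const.indicator hA).aestronglyMeasurable, (hlaw i).map_eq]
  simp [integral_indicator hA]

theorem integral_countIn [IsProbabilityMeasure P] (hlaw : ∀ i, HasLaw (W i) μ P)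
    (s : Finset ℕ) {A : Set 𝒳} (hA : MeasurableSet A) :
    ∫ ω, countIn s A (fun i => W i ω) ∂P = s.card * μ.real A := by
  simp only [countIn]
  rw [integral_finsetSum _ fun i _ =>
    memLp_one_iff_integrable.1 (memLp_indicator_one_comp hlaw hA i)]
  simp [integral_indicator_one_comp hlaw hA]

/-- Markov's inequality for counts. -/
theorem measureReal_le_countIn_le [IsProbabilityMeasure P] (hlaw : ∀ i, HasLaw (W i) μ P)
    (s : Finset ℕ) {A : Set 𝒳} (hA : MeasurableSet A) {ε : ℝ} (hε : 0 < ε) :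
    P.real {ω | ε ≤ countIn s A fun i => W i ω} ≤ s.card * μ.real A / ε := by
  rw [le_div_iff₀ hε, mul_comm, ← integral_countIn hlaw s hA]
  refine mul_meas_ge_le_integral_of_nonneg (Eventually.of_forall fun ω =>
    Finset.sum_nonneg fun i _ => Set.indicator_nonneg (fun _ _ => zero_le_one) _) ?_ _
  exact integrable_finsetSum _ fun i _ =>
    memLp_one_iff_integrable.1 (memLp_indicator_one_comp hlaw hA i)

/-- Chebyshev's inequality for counts. -/
theorem measureReal_le_abs_countIn_sub_le [IsProbabilityMeasure P] (hW : iIndepFun W P)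
    (hlaw : ∀ i, HasLaw (W i) μ P) (s : Finset ℕ) {A : Set 𝒳} (hA : MeasurableSet A) {ε : ℝ} (hε : 0 < ε) :
    P.real {ω | ε ≤ |countIn s A (fun i => W i ω) - s.card * μ.real A|} ≤
      s.card * μ.real A / ε ^ 2 := by
  set f : ℕ → Ω → ℝ := fun i ω => A.indicator (fun _ => (1 : ℝ)) (W i ω) with hf
  have hL : ∀ i, MemLp (f i) 2 P := fun i => memLp_indicator_one_comp hlaw hA i
  have hind : iIndepFun f P :=
    hW.comp (fun _ => A.indicator fun _ => (1 : ℝ)) fun _ => measurable_const.indicator hA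
  have hsum : (fun ω => countIn s A fun i => W i ω) = ∑ i ∈ s, f i := by
    ext ω; simp [countIn, hf]
  have hvar : Var[∑ i ∈ s, f i; P] ≤ s.card * μ.real A := by
    rw [IndepFun.variance_sum (fun i _ => hL i)
      fun i _ j _ hij => hind.indepFun hij]
    rw [← nsmul_eq_mul]
    refine Finset.sum_le_card_nsmul _ _ _ fun i _ => ?_
    -- An indicator equals its square, so its variance is at most its mean.
    refine (variance_le_expectation_sq (hL i).aestronglyMeasurable).trans_eq ?_
    rw [← integral_indicator_one_comp hlaw hA i]
    congr 1
    ext ω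
    by_cases h : W i ω ∈ A <;> simp [hf, h]
  have hL2 : MemLp (∑ i ∈ s, f i) 2 P := memLp_finsetSum' _ fun i _ => hL i
  have h := meas_ge_le_variance_div_sq hL2 hε
  have hmean := integral_countIn hlaw s hA
  rw [hsum] at hmean
  have hint : ∀ ω, countIn s A (fun i => W i ω) = (∑ i ∈ s, f i) ω := fun ω => congrFun hsum ω
  simp_rw [hint]
  rw [hmean] at h
  refine (ENNReal.toReal_mono ENNReal.ofReal_ne_top h).trans ?_
  rw [ENNReal.toReal_ofReal (div_nonneg (variance_nonneg _ _) (sq_nonneg _))]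
  exact div_le_div_of_nonneg_right hvar (sq_nonneg _)

end CountIn

/-! ### Asymptotic normality for counts of nested rare events. -/

section Nested

variable {Ω 𝒳 : Type*} [MeasurableSpace Ω] [MeasurableSpace 𝒳] {μ : Measure 𝒳}
  [IsProbabilityMeasure μ]

/-- The linear combination `∑ a_j ((j + 2) 1_{B (j + 1)} - (j + 1) 1_{B j})`. -/
def weightedIncr {𝒳 : Type*} (a : ℕ → ℝ) (K : ℕ) (B : ℕ → Set 𝒳) (x : 𝒳) : ℝ :=
  ∑ j ∈ Finset.range K, a j * ((((j + 1 : ℕ) : ℝ) + 1) * (B (j + 1)).indicator (fun _ => 1) x -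
    ((j : ℝ) + 1) * (B j).indicator (fun _ => 1) x)

theorem measurable_weightedIncr (a : ℕ → ℝ) (K : ℕ) {B : ℕ → Set 𝒳}
    (hB : ∀ j, MeasurableSet (B j)) : Measurable (weightedIncr a K B) := by
  have h : ∀ j, Measurable ((B j).indicator fun _ => (1 : ℝ)) := fun j =>
    measurable_const.indicator (hB j)
  exact Finset.measurable_fun_sum _ fun j _ =>
    (((h (j + 1)).const_mul _).sub ((h j).const_mul _)).const_mul _

theorem abs_weightedIncr_le {𝒳 : Type*} (a : ℕ → ℝ) (K : ℕ) (B : ℕ → Set 𝒳) (x : 𝒳) :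
    |weightedIncr a K B x| ≤ ∑ j ∈ Finset.range K, |a j| * (2 * j + 3) := by
  refine (Finset.abs_sum_le_sum_abs _ _).trans (Finset.sum_le_sum fun j _ => ?_)
  rw [abs_mul]
  refine mul_le_mul_of_nonneg_left ?_ (abs_nonneg _)
  refine (abs_sub _ _).trans ?_
  rw [abs_mul, abs_mul, abs_of_nonneg (by positivity : (0 : ℝ) ≤ ((j + 1 : ℕ) : ℝ) + 1),
    abs_of_nonneg (by positivity : (0 : ℝ) ≤ (j : ℝ) + 1)]
  have h1 := mul_le_of_le_one_right (by positivity : (0 : ℝ) ≤ ((j + 1 : ℕ) : ℝ) + 1)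
    (abs_indicator_one_le (B (j + 1)) x)
  have h2 := mul_le_of_le_one_right (by positivity : (0 : ℝ) ≤ (j : ℝ) + 1)
    (abs_indicator_one_le (B j) x)
  push_cast at *
  linarith

theorem integral_weightedIncr (a : ℕ → ℝ) (K : ℕ) {B : ℕ → Set 𝒳}
    (hB : ∀ j, MeasurableSet (B j)) :
    ∫ x, weightedIncr a K B x ∂μ = ∑ j ∈ Finset.range K,
      a j * ((((j + 1 : ℕ) : ℝ) + 1) * μ.real (B (j + 1)) - ((j : ℝ) + 1) * μ.real (B j)) := by
  have hi : ∀ (j : ℕ) (b : ℝ), Integrable (fun x => b * (B j).indicator (fun _ => (1 : ℝ)) x) μ :=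
    fun j b => ((integrable_const 1).indicator (hB j)).const_mul b
  have hterm : ∀ j : ℕ, Integrable (fun x => a j *
      ((((j + 1 : ℕ) : ℝ) + 1) * (B (j + 1)).indicator (fun _ => 1) x -
        ((j : ℝ) + 1) * (B j).indicator (fun _ => 1) x)) μ := fun j =>
    ((hi _ _).sub (hi _ _)).const_mul _
  simp only [weightedIncr]
  rw [integral_finsetSum _ fun j _ => hterm j]
  refine Finset.sum_congr rfl fun j _ => ?_
  rw [integral_const_mul, integral_sub (hi _ _) (hi _ _), integral_const_mul, integral_const_mul]
  simp [integral_indicator (hB _)]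

/-- By nestedness a product of two indicators is the indicator of the smaller event, the one with
the larger index. -/
theorem integral_weightedIncr_sq (a : ℕ → ℝ) (K : ℕ) {B : ℕ → Set 𝒳}
    (hB : ∀ j, MeasurableSet (B j)) (hanti : Antitone B) :
    ∫ x, weightedIncr a K B x ^ 2 ∂μ = ∑ j ∈ Finset.range K, ∑ l ∈ Finset.range K, a j * a l *
      ((((j + 1 : ℕ) : ℝ) + 1) * (((l + 1 : ℕ) : ℝ) + 1) * μ.real (B (max (j + 1) (l + 1))) -
       (((j + 1 : ℕ) : ℝ) + 1) * ((l : ℝ) + 1) * μ.real (B (max (j + 1) l)) -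
       ((j : ℝ) + 1) * (((l + 1 : ℕ) : ℝ) + 1) * μ.real (B (max j (l + 1))) +
       ((j : ℝ) + 1) * ((l : ℝ) + 1) * μ.real (B (max j l))) := by
  have hmul : ∀ i j x, (B i).indicator (fun _ => (1 : ℝ)) x * (B j).indicator (fun _ => 1) x =
      (B (max i j)).indicator (fun _ => 1) x := by
    intro i j x
    have h : B (max i j) = B i ∩ B j := by
      rcases le_total i j with hij | hij
      · rw [max_eq_right hij, Set.inter_eq_right.2 (hanti hij)]
      · rw [max_eq_left hij, Set.inter_eq_left.2 (hanti hij)]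
    rw [h]
    by_cases h1 : x ∈ B i <;> by_cases h2 : x ∈ B j <;> simp [h1, h2]
  have hi : ∀ (j : ℕ) (b : ℝ), Integrable (fun x => b * (B j).indicator (fun _ => (1 : ℝ)) x) μ :=
    fun j b => ((integrable_const 1).indicator (hB j)).const_mul b
  have hexp : ∀ x, weightedIncr a K B x ^ 2 = ∑ j ∈ Finset.range K, ∑ l ∈ Finset.range K,
      a j * a l *
      ((((j + 1 : ℕ) : ℝ) + 1) * (((l + 1 : ℕ) : ℝ) + 1) *
        (B (max (j + 1) (l + 1))).indicator (fun _ => 1) x -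
       (((j + 1 : ℕ) : ℝ) + 1) * ((l : ℝ) + 1) * (B (max (j + 1) l)).indicator (fun _ => 1) x -
       ((j : ℝ) + 1) * (((l + 1 : ℕ) : ℝ) + 1) * (B (max j (l + 1))).indicator (fun _ => 1) x +
       ((j : ℝ) + 1) * ((l : ℝ) + 1) * (B (max j l)).indicator (fun _ => 1) x) := by
    intro x
    rw [weightedIncr, pow_two, Finset.sum_mul_sum]
    refine Finset.sum_congr rfl fun j _ => Finset.sum_congr rfl fun l _ => ?_
    simp only [← hmul]
    ring
  have hterm : ∀ j l, Integrable (fun x => a j * a l *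
      ((((j + 1 : ℕ) : ℝ) + 1) * (((l + 1 : ℕ) : ℝ) + 1) *
        (B (max (j + 1) (l + 1))).indicator (fun _ => 1) x -
       (((j + 1 : ℕ) : ℝ) + 1) * ((l : ℝ) + 1) * (B (max (j + 1) l)).indicator (fun _ => 1) x -
       ((j : ℝ) + 1) * (((l + 1 : ℕ) : ℝ) + 1) * (B (max j (l + 1))).indicator (fun _ => 1) x +
       ((j : ℝ) + 1) * ((l : ℝ) + 1) * (B (max j l)).indicator (fun _ => 1) x)) μ := fun j l =>
    ((((hi _ _).sub (hi _ _)).sub (hi _ _)).add (hi _ _)).const_mul _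
  simp_rw [hexp]
  rw [integral_finsetSum _ fun j _ => integrable_finsetSum _ fun l _ => hterm j l]
  refine Finset.sum_congr rfl fun j _ => ?_
  rw [integral_finsetSum _ fun l _ => hterm j l]
  refine Finset.sum_congr rfl fun l _ => ?_
  have hi2 : ∀ (i j : ℕ) (b b' : ℝ), Integrable (fun x =>
      b * (B i).indicator (fun _ => (1 : ℝ)) x - b' * (B j).indicator (fun _ => (1 : ℝ)) x) μ :=
    fun i j b b' => (hi i b).sub (hi j b')
  have hi3 : ∀ (i j l : ℕ) (b b' b'' : ℝ), Integrable (fun x =>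
      b * (B i).indicator (fun _ => (1 : ℝ)) x - b' * (B j).indicator (fun _ => (1 : ℝ)) x -
        b'' * (B l).indicator (fun _ => (1 : ℝ)) x) μ :=
    fun i j l b b' b'' => (hi2 i j b b').sub (hi l b'')
  rw [integral_const_mul, integral_add (hi3 _ _ _ _ _ _) (hi _ _), integral_sub (hi2 _ _ _ _)
    (hi _ _), integral_sub (hi _ _) (hi _ _)]
  simp_rw [integral_const_mul]
  simp [integral_indicator (hB _)]

/-- The weighted second moments tend to D (min(i,j) + 1), and the mixed second difference of min is
the Kronecker delta. The index is shifted: `B n j` carries the weight j + 1. -/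
theorem tendsto_integral_weightedIncr_sq_div (a : ℕ → ℝ) (K : ℕ) {B : ℕ → ℕ → Set 𝒳}
    (hB : ∀ n j, MeasurableSet (B n j)) (hanti : ∀ᶠ n in atTop, Antitone (B n)) {c : ℕ → ℝ} {D : ℝ}
    (hp : ∀ j : ℕ, Tendsto (fun n => μ.real (B n j) / c n) atTop (𝓝 (D / (j + 1)))) :
    Tendsto (fun n => (∫ x, weightedIncr a K (B n) x ^ 2 ∂μ) / c n) atTop
      (𝓝 (D * ∑ j ∈ Finset.range K, a j ^ 2)) := by
  have hq : ∀ i j : ℕ, Tendsto (fun n => ((i : ℝ) + 1) * (j + 1) * μ.real (B n (max i j)) / c n)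
      atTop (𝓝 (D * ((min i j : ℕ) + 1))) := by
    intro i j
    have h := (hp (max i j)).const_mul (((i : ℝ) + 1) * (j + 1))
    have he : ((i : ℝ) + 1) * (j + 1) * (D / ((max i j : ℕ) + 1)) = D * ((min i j : ℕ) + 1) := by
      rcases le_total i j with hij | hij
      · rw [max_eq_right hij, min_eq_left hij]; field_simp
      · rw [max_eq_left hij, min_eq_right hij]; field_simp
    rw [he] at h
    exact h.congr fun n => by ring
  have hlim := tendsto_finsetSum (Finset.range K) fun j _ =>
    tendsto_finsetSum (Finset.range K) fun l _ =>
      ((((hq (j + 1) (l + 1)).sub (hq (j + 1) l)).sub (hq j (l + 1))).add (hq j l)).const_mul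
        (a j * a l)
  have hval : ∑ j ∈ Finset.range K, ∑ l ∈ Finset.range K, a j * a l *
      (D * ((min (j + 1) (l + 1) : ℕ) + 1) - D * ((min (j + 1) l : ℕ) + 1) -
        D * ((min j (l + 1) : ℕ) + 1) + D * ((min j l : ℕ) + 1)) =
      D * ∑ j ∈ Finset.range K, a j ^ 2 := by
    rw [Finset.mul_sum]
    refine Finset.sum_congr rfl fun j hj => ?_
    rw [Finset.sum_eq_single_of_mem j hj]
    · rw [min_self, min_self, min_eq_right (Nat.le_succ j), min_eq_left (Nat.le_succ j)]
      push_cast; ring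
    · intro l _ hlj
      rcases Nat.lt_or_gt_of_ne hlj with h | h
      · rw [min_eq_right (by omega), min_eq_right (by omega), min_eq_right (by omega : l + 1 ≤ j),
          min_eq_right (by omega)]
        ring
      · rw [min_eq_left (by omega), min_eq_left (by omega : j + 1 ≤ l), min_eq_left (by omega),
          min_eq_left (by omega)]
        ring
  rw [hval] at hlim
  refine hlim.congr' (hanti.mono fun n hn => ?_)
  dsimp only
  rw [integral_weightedIncr_sq a K (hB n) hn, Finset.sum_div]
  refine Finset.sum_congr rfl fun j _ => ?_
  rw [Finset.sum_div]
  refine Finset.sum_congr rfl fun l _ => ?_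
  ring

variable {P : Measure Ω} [IsProbabilityMeasure P] {W : ℕ → Ω → 𝒳}

/-- The sine-transformed increments of `(j + 1) N j / S`. -/
def transformedIncr (k : ℕ) (S : ℝ) (N : ℕ → ℝ) (i : Fin (k - 1)) : ℝ :=
  ∑ j ∈ Finset.range (k - 1), sinRow k (i + 1) (j + 1) *
    ((((j + 1 : ℕ) : ℝ) + 1) * N (j + 1) / S - ((j : ℝ) + 1) * N j / S)

/-- Central limit theorem for the sine-transformed increments of counts of nested rare events. -/
theorem tendstoInDistribution_transformedIncr {Ω' : Type*} [MeasurableSpace Ω'] {P' : Measure Ω'}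
    [IsProbabilityMeasure P'] (hW : iIndepFun W P) (hWm : ∀ i, Measurable (W i))
    (hlaw : ∀ i, HasLaw (W i) μ P) {M : ℕ → Finset ℕ}
    (hm : Tendsto (fun n => (M n).card) atTop atTop)
    {B : ℕ → ℕ → Set 𝒳} (hB : ∀ n j, MeasurableSet (B n j)) (hanti : ∀ᶠ n in atTop, Antitone (B n))
    {c : ℕ → ℝ} {D : ℝ} (hD : 0 < D) (hc : ∀ n, 0 < c n)
    (hmc : Tendsto (fun n => ((M n).card : ℝ) * c n) atTop atTop)
    (hp : ∀ j : ℕ, Tendsto (fun n => μ.real (B n j) / c n) atTop (𝓝 (D / (j + 1))))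
    (hbias : ∀ j : ℕ, Tendsto (fun n => (M n).card * (((j : ℝ) + 1) * μ.real (B n j) - D * c n) /
      √((M n).card * c n * D)) atTop (𝓝 0))
    {k : ℕ} {ξ : Fin (k - 1) → Ω' → ℝ} (hξ : ∀ i, HasLaw (ξ i) (gaussianReal 0 1) P')
    (hind : iIndepFun ξ P') :
    TendstoInDistribution (fun n ω => WithLp.toLp 2 fun i => transformedIncr k
        √((M n).card * c n * D) (fun j => countIn (M n) (B n j) fun i => W i ω) i) atTop
      (fun ω => WithLp.toLp 2 fun i => ξ i ω) (fun _ => P) P' := by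
  set S : ℕ → ℝ := fun n => √((M n).card * c n * D) with hS
  have hSt : Tendsto S atTop atTop :=
    Real.tendsto_sqrt_atTop.comp (hmc.atTop_mul_const hD)
  refine tendstoInDistribution_toLp_of_tendsto hξ hind
    (η := fun n i ω => transformedIncr k (S n) (fun j => countIn (M n) (B n j) fun i => W i ω) i)
    ?_ ?_
  · intro n i
    have h : ∀ j, Measurable fun ω => countIn (M n) (B n j) fun i => W i ω := fun j =>
      measurable_countIn hWm _ (hB n j)
    exact (Finset.measurable_fun_sum _ fun j _ => ((((h (j + 1)).const_mul _).div_const _).sub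
      (((h j).const_mul _).div_const _)).const_mul _).aemeasurable
  intro s
  -- Interchanging the sums turns the projection on `s` into a sum over the sample of i.i.d. bounded
  -- variables.
  set a : ℕ → ℝ := fun j => ∑ i : Fin (k - 1), s i * sinRow k (i + 1) (j + 1) with ha
  have hsum : ∀ n ω, ∑ i, s i * transformedIncr k (S n)
      (fun j => countIn (M n) (B n j) fun i => W i ω) i =
      ∑ i ∈ M n, weightedIncr a (k - 1) (B n) (W i ω) / S n := by
    intro n ω
    simp only [transformedIncr, weightedIncr, Finset.mul_sum, Finset.sum_div]
    rw [Finset.sum_comm, Finset.sum_comm (s := M n)]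
    refine Finset.sum_congr rfl fun j _ => ?_
    simp only [countIn, ha]
    simp_rw [← mul_assoc]
    rw [← Finset.sum_mul, ← Finset.sum_div, ← Finset.mul_sum, Finset.sum_sub_distrib,
      ← Finset.mul_sum, ← Finset.mul_sum]
    ring
  simp_rw [hsum]
  have hlim := tendsto_charFun_sum_of_bounded (v := ∑ i, s i ^ 2) hW hlaw hm
    (Y := fun n x => weightedIncr a (k - 1) (B n) x / S n)
    (fun n => (measurable_weightedIncr a (k - 1) (hB n)).div_const _)
    (b := fun n => (∑ j ∈ Finset.range (k - 1), |a j| * (2 * j + 3)) / S n)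
    (hSt.const_div_atTop _) ?_ ?_ ?_
  · exact hlim
  · intro n x
    rw [abs_div, abs_of_nonneg (Real.sqrt_nonneg _)]
    exact div_le_div_of_nonneg_right (abs_weightedIncr_le _ _ _ _) (Real.sqrt_nonneg _)
  -- No centring is needed: the common leading mean m c D cancels in each increment, leaving the
  -- bias terms.
  · have h := tendsto_finsetSum (Finset.range (k - 1)) fun j _ =>
      ((hbias (j + 1)).sub (hbias j)).const_mul (a j)
    simp only [sub_zero, mul_zero, Finset.sum_const_zero] at h
    refine h.congr fun n => ?_
    rw [integral_div, integral_weightedIncr a (k - 1) (hB n), Finset.sum_div, Finset.mul_sum]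
    refine Finset.sum_congr rfl fun j _ => ?_
    simp only [hS]
    ring
  · have h := (tendsto_integral_weightedIncr_sq_div a (k - 1) hB hanti hp).div_const D
    rw [mul_div_cancel_left₀ _ hD.ne', sum_sq_sum_sinRow] at h
    refine h.congr' ?_
    filter_upwards [hm.eventually_gt_atTop 0] with n hn
    have hn' : ((M n).card : ℝ) ≠ 0 := by exact_mod_cast hn.ne'
    have hc' := (hc n).ne'
    simp_rw [div_pow]
    rw [integral_div, hS, Real.sq_sqrt (mul_nonneg (mul_nonneg (Nat.cast_nonneg _) (hc n).le) hD.le)]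
    field_simp

end Nested

/-! ### Exceedances of continuous paths. -/

section Paths

/-- The set of paths that exceed the level `y` at a time of a fixed dense sequence. -/
def exceed (y : ℝ) : Set (unitInterval → ℝ) :=
  {x | ∃ m, y < x (TopologicalSpace.denseSeq unitInterval m)}

theorem measurableSet_exceed (y : ℝ) : MeasurableSet (exceed y) := by
  have : exceed y = ⋃ m, {x | y < x (TopologicalSpace.denseSeq unitInterval m)} := by
    ext x; simp [exceed]
  rw [this]
  exact MeasurableSet.iUnion fun m => measurableSet_lt measurable_const (measurable_pi_apply _)

theorem antitone_exceed : Antitone exceed := fun _ _ h _ ⟨m, hm⟩ => ⟨m, h.trans_lt hm⟩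

/-- The exceedance times of a continuous path form an open set, which meets the dense sequence if
nonempty. Countably many times keep the event measurable for the product σ-algebra. -/
theorem mem_exceed_iff {x : unitInterval → ℝ} (hx : Continuous x) {y : ℝ} :
    x ∈ exceed y ↔ ∃ t, y < x t := by
  refine ⟨fun ⟨m, hm⟩ => ⟨_, hm⟩, fun ⟨t, ht⟩ => ?_⟩
  obtain ⟨m, hm⟩ := (TopologicalSpace.denseRange_denseSeq unitInterval).exists_mem_open
    (isOpen_lt continuous_const hx) ⟨t, ht⟩
  exact ⟨m, hm⟩

theorem volume_unitInterval_pos_of_isOpen {U : Set unitInterval} (hU : IsOpen U)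
    (hne : U.Nonempty) : 0 < (volume : Measure unitInterval) U := by
  obtain ⟨V, hV, rfl⟩ := isOpen_induced_iff.1 hU
  obtain ⟨t, ht⟩ := hne
  -- A neighborhood of an endpoint also meets the open interval, where Lebesgue measure sees it.
  have htc : (t : ℝ) ∈ closure (Set.Ioo (0 : ℝ) 1) := by
    rw [closure_Ioo zero_ne_one]; exact t.2
  have hne' : (V ∩ Set.Ioo (0 : ℝ) 1).Nonempty := mem_closure_iff.1 htc V hV ht
  have hpos : 0 < (volume : Measure ℝ) (V ∩ Set.Ioo (0 : ℝ) 1) :=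
    (hV.inter isOpen_Ioo).measure_pos _ hne'
  rw [unitInterval.volume_apply]
  refine hpos.trans_le (measure_mono ?_)
  rintro z ⟨hz, hz1⟩
  exact ⟨⟨z, Set.Ioo_subset_Icc_self hz1⟩, hz, rfl⟩

/-- The set of times above the level is open, hence of positive measure once nonempty; the upper
bound 1 is automatic. -/
theorem indicator_sojournAbove {x : unitInterval → ℝ} (hx : Continuous x) (y : ℝ) :
    (Set.Ioc (0 : ℝ) 1).indicator (fun _ => (1 : ℝ)) (sojournAbove x y) =
      (exceed y).indicator (fun _ => 1) x := by
  have hopen : IsOpen {t | y < x t} := isOpen_lt continuous_const hx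
  have hs : sojournAbove x y = (volume : Measure unitInterval).real {t | y < x t} := by
    have : ∀ t, (Set.Ioi y).indicator (fun _ => (1 : ℝ)) (x t) =
      {t | y < x t}.indicator (fun _ => (1 : ℝ)) t := fun t => rfl
    simp_rw [sojournAbove, this]
    rw [integral_indicator hopen.measurableSet]
    simp
  have hiff : sojournAbove x y ∈ Set.Ioc (0 : ℝ) 1 ↔ x ∈ exceed y := by
    rw [mem_exceed_iff hx, hs]
    constructor
    · intro h
      by_contra hne
      push Not at hne
      have : {t | y < x t} = ∅ := by
        ext t; simpa using hne t
      rw [this] at h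
      simp at h
    · intro ⟨t, ht⟩
      refine ⟨?_, measureReal_le_one⟩
      rw [measureReal_def]
      exact ENNReal.toReal_pos (volume_unitInterval_pos_of_isOpen hopen ⟨t, ht⟩).ne'
        (measure_ne_top _ _)
  by_cases h : x ∈ exceed y
  · rw [Set.indicator_of_mem h, Set.indicator_of_mem (hiff.2 h)]
  · rw [Set.indicator_of_notMem h, Set.indicator_of_notMem (fun h' => h (hiff.1 h'))]

theorem nHat_eq_countIn {x : ℕ → unitInterval → ℝ} (hx : ∀ i, Continuous (x i)) (n : ℕ)
    (M : Finset ℕ) (c : ℝ) (j : ℕ) :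
    nHat n M x c j = countIn M (exceed (genInv (empDF n x) (1 - c / j))) x :=
  Finset.sum_congr rfl fun i _ => indicator_sojournAbove (hx i) _

/-- A path counted at only one of `y`, `z` exceeds `a` but not `b`. The bound does not involve `y`
and `z`, so `y` may be random. -/
theorem abs_countIn_exceed_sub_le (M : Finset ℕ) (x : ℕ → unitInterval → ℝ) {a b y z : ℝ}
    (hay : a ≤ y) (hyb : y ≤ b) (haz : a ≤ z) (hzb : z ≤ b) :
    |countIn M (exceed y) x - countIn M (exceed z) x| ≤ countIn M (exceed a \ exceed b) x := by
  simp only [countIn]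
  rw [← Finset.sum_sub_distrib]
  refine (Finset.abs_sum_le_sum_abs _ _).trans (Finset.sum_le_sum fun i _ => ?_)
  have h1 := @antitone_exceed _ _ hay (x i)
  have h2 := @antitone_exceed _ _ hyb (x i)
  have h3 := @antitone_exceed _ _ haz (x i)
  have h4 := @antitone_exceed _ _ hzb (x i)
  by_cases hy : x i ∈ exceed y <;> by_cases hz : x i ∈ exceed z
  · rw [Set.indicator_of_mem hy, Set.indicator_of_mem hz, sub_self, abs_zero]
    exact Set.indicator_nonneg (fun _ _ => zero_le_one) _
  · have : x i ∈ exceed a \ exceed b := ⟨h1 hy, fun h => hz (h4 h)⟩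
    rw [Set.indicator_of_mem hy, Set.indicator_of_notMem hz, Set.indicator_of_mem this]
    norm_num
  · have : x i ∈ exceed a \ exceed b := ⟨h3 hz, fun h => hy (h2 h)⟩
    rw [Set.indicator_of_notMem hy, Set.indicator_of_mem hz, Set.indicator_of_mem this]
    norm_num
  · rw [Set.indicator_of_notMem hy, Set.indicator_of_notMem hz, sub_self, abs_zero]
    exact Set.indicator_nonneg (fun _ _ => zero_le_one) _

end Paths

/-! ### Empirical distribution functions and quantiles. -/

section EmpiricalQuantile

theorem empDF_mono (n : ℕ) (x : ℕ → unitInterval → ℝ) : Monotone (empDF n x) := by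
  intro y z hyz
  refine mul_le_mul_of_nonneg_left (Finset.sum_le_sum fun i _ => ?_) (by positivity)
  exact Set.indicator_le_indicator_of_subset (Set.Iic_subset_Iic.2 hyz)
    (fun _ => zero_le_one) _

theorem empDF_nonneg (n : ℕ) (x : ℕ → unitInterval → ℝ) (y : ℝ) : 0 ≤ empDF n x y :=
  mul_nonneg (by positivity)
    (Finset.sum_nonneg fun _ _ => Set.indicator_nonneg (fun _ _ => zero_le_one) _)

theorem countIn_time_zero_gt {n : ℕ} (hn : 0 < n) (x : ℕ → unitInterval → ℝ) (y : ℝ) :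
    countIn (Finset.range n) {x | y < x 0} x = n * (1 - empDF n x y) := by
  have hn' : (n : ℝ) ≠ 0 := by exact_mod_cast hn.ne'
  rw [empDF, mul_sub, mul_inv_cancel_left₀ hn', mul_one, countIn, eq_sub_iff_add_eq,
    ← Finset.sum_add_distrib]
  have : ∀ i ∈ Finset.range n, {x : unitInterval → ℝ | y < x 0}.indicator (fun _ => (1 : ℝ)) (x i) +
      (Set.Iic y).indicator (fun _ => (1 : ℝ)) (x i 0) = 1 := by
    intro i _
    by_cases h : y < x i 0
    · rw [Set.indicator_of_mem (by exact h), Set.indicator_of_notMem (by simpa using h), add_zero]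
    · rw [Set.indicator_of_notMem (by exact h), Set.indicator_of_mem (by simpa using h), zero_add]
  rw [Finset.sum_congr rfl this]
  simp

theorem nonempty_setOf_le_empDF {n : ℕ} (hn : 0 < n) (x : ℕ → unitInterval → ℝ) {q : ℝ}
    (hq : q ≤ 1) : {y | q ≤ empDF n x y}.Nonempty := by
  obtain ⟨y, hy⟩ := ((Finset.range n).image fun i => x i 0).exists_le
  refine ⟨y, hq.trans_eq ?_⟩
  have hn' : (n : ℝ) ≠ 0 := by exact_mod_cast hn.ne'
  have : ∀ i ∈ Finset.range n, (Set.Iic y).indicator (fun _ => (1 : ℝ)) (x i 0) = 1 :=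
    fun i hi => Set.indicator_of_mem (Set.mem_Iic.2 (hy _ (Finset.mem_image_of_mem _ hi))) _
  rw [empDF, Finset.sum_congr rfl this]
  simp [hn']

theorem bddBelow_setOf_le_empDF (n : ℕ) (x : ℕ → unitInterval → ℝ) {q : ℝ}
    (hq : 0 < q) : BddBelow {y | q ≤ empDF n x y} := by
  obtain ⟨z, hz⟩ := ((Finset.range n).image fun i => x i 0).bddBelow
  refine ⟨z, fun y hy => ?_⟩
  by_contra hyz
  push Not at hyz
  have : ∀ i ∈ Finset.range n, (Set.Iic y).indicator (fun _ => (1 : ℝ)) (x i 0) = 0 :=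
    fun i hi => Set.indicator_of_notMem
      (by simpa using hyz.trans_le (hz (Finset.mem_image_of_mem _ hi))) _
  have h0 : empDF n x y = 0 := by
    rw [empDF, Finset.sum_congr rfl this]; simp
  have : q ≤ empDF n x y := hy
  linarith

theorem genInv_empDF_le {n : ℕ} (x : ℕ → unitInterval → ℝ) {q y : ℝ} (hq : 0 < q)
    (h : q ≤ empDF n x y) : genInv (empDF n x) q ≤ y :=
  csInf_le (bddBelow_setOf_le_empDF n x hq) h

theorem le_genInv_empDF {n : ℕ} (hn : 0 < n) (x : ℕ → unitInterval → ℝ) {q y : ℝ} (hq : q ≤ 1)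
    (h : empDF n x y < q) : y ≤ genInv (empDF n x) q := by
  refine le_csInf (nonempty_setOf_le_empDF hn x hq) fun z hz => ?_
  by_contra hzy
  push Not at hzy
  have h1 : q ≤ empDF n x z := hz
  have h2 := empDF_mono n x hzy.le
  linarith

variable {Ω : Type*} [MeasurableSpace Ω] {Xs : ℕ → Ω → unitInterval → ℝ}

theorem measurable_empDF (hX : ∀ i t, Measurable fun ω => Xs i ω t) (n : ℕ) (y : ℝ) :
    Measurable fun ω => empDF n (fun i => Xs i ω) y :=
  (Finset.measurable_fun_sum _ fun i _ =>
    (measurable_const.indicator measurableSet_Iic).comp (hX i 0)).const_mul _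

theorem measurable_genInv_empDF (hX : ∀ i t, Measurable fun ω => Xs i ω t) (n : ℕ) {q : ℝ}
    (hq : q ≤ 1) : Measurable fun ω => genInv (empDF n fun i => Xs i ω) q := by
  -- For n = 0 or q ≤ 0 the set under the infimum is empty or the whole line, and `sInf` returns the
  -- conventional value 0.
  rcases Nat.eq_zero_or_pos n with rfl | hn
  · have : ∀ ω, empDF 0 (fun i => Xs i ω) = fun _ => 0 := by intro ω; ext y; simp [empDF]
    simp_rw [this]
    exact measurable_const
  rcases le_or_gt q 0 with hq0 | hq0
  · have : ∀ ω, {y | q ≤ empDF n (fun i => Xs i ω) y} = Set.univ := fun ω =>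
      Set.eq_univ_of_forall fun y => hq0.trans (empDF_nonneg _ _ _)
    simp_rw [genInv, this]
    exact measurable_const
  refine measurable_of_Iio fun a => ?_
  -- By monotonicity an infimum below `a` is witnessed by a rational point below `a`.
  have : (fun ω => genInv (empDF n fun i => Xs i ω) q) ⁻¹' Set.Iio a =
      ⋃ r : ℚ, ⋃ _ : (r : ℝ) < a, {ω | q ≤ empDF n (fun i => Xs i ω) r} := by
    ext ω
    simp only [Set.mem_preimage, Set.mem_Iio, Set.mem_iUnion, Set.mem_ofPred_eq, exists_prop]
    constructor
    · intro h
      obtain ⟨s, hs, hsa⟩ := exists_lt_of_csInf_lt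
        (nonempty_setOf_le_empDF hn (fun i => Xs i ω) hq) h
      obtain ⟨r, hr1, hr2⟩ := exists_rat_btwn hsa
      have hs' : q ≤ empDF n (fun i => Xs i ω) s := hs
      exact ⟨r, hr2, hs'.trans (empDF_mono _ _ hr1.le)⟩
    · rintro ⟨r, hr, h⟩
      exact (genInv_empDF_le _ hq0 h).trans_lt hr
  rw [this]
  exact MeasurableSet.iUnion fun r => MeasurableSet.iUnion fun _ =>
    measurableSet_le measurable_const (measurable_empDF hX n r)

theorem measurable_nHat (hX : ∀ i, IsContProcess (Xs i)) (n : ℕ) (M : Finset ℕ) {c : ℝ}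
    (hc : 0 ≤ c) (j : ℕ) : Measurable fun ω => nHat n M (fun i => Xs i ω) c j := by
  have h : ∀ ω, nHat n M (fun i => Xs i ω) c j = _ := fun ω =>
    nHat_eq_countIn (fun i => (hX i).continuous_path ω) n M c j
  simp_rw [h, countIn]
  refine Finset.measurable_fun_sum _ fun i _ => ?_
  have hq : 1 - c / j ≤ 1 := by
    have : 0 ≤ c / j := by positivity
    linarith
  have hg := measurable_genInv_empDF (fun i t => (hX i).measurable_coord t) n hq
  set A : Set Ω := {ω | Xs i ω ∈ exceed (genInv (empDF n fun i => Xs i ω) (1 - c / j))} with hA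
  have hAm : MeasurableSet A := by
    have : A = ⋃ m, {ω | genInv (empDF n fun i => Xs i ω) (1 - c / j) <
        Xs i ω (TopologicalSpace.denseSeq unitInterval m)} := by
      ext ω; simp [hA, exceed]
    rw [this]
    exact MeasurableSet.iUnion fun m => measurableSet_lt hg ((hX i).measurable_coord _)
  exact (measurable_const (a := (1 : ℝ))).indicator hAm

theorem measurable_nHatMean (hX : ∀ i, IsContProcess (Xs i)) (k n : ℕ) (M : Finset ℕ) {c : ℝ}
    (hc : 0 ≤ c) : Measurable fun ω => nHatMean k n M (fun i => Xs i ω) c :=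
  (Finset.measurable_fun_sum _ fun l _ => (measurable_nHat hX n M hc l).const_mul _).const_mul _

end EmpiricalQuantile

/-! ### True quantile levels. -/

section Level

/-- The largest point at which a distribution function does not exceed `q`. -/
def upperLevel (F : ℝ → ℝ) (q : ℝ) : ℝ := sSup {x | F x ≤ q}

variable {Ω₀ : Type*} [MeasurableSpace Ω₀] {P₀ : Measure Ω₀} [IsProbabilityMeasure P₀]
  {X : Ω₀ → unitInterval → ℝ}

theorem IsContProcess.measurable (hX : IsContProcess X) : Measurable X :=
  measurable_pi_lambda _ hX.measurable_coord

theorem marginDF_eq_cdf (hX : IsContProcess X) :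
    marginDF P₀ X = cdf (P₀.map fun ω => X ω 0) := by
  have : IsProbabilityMeasure (P₀.map fun ω => X ω 0) :=
    Measure.isProbabilityMeasure_map (hX.measurable_coord 0).aemeasurable
  ext x
  rw [cdf_eq_real, map_measureReal_apply (hX.measurable_coord 0) measurableSet_Iic]
  rfl

/-- Taking the largest point makes the equivalence hold even where the distribution function is
flat; continuity ensures that the value q is attained. -/
theorem upperLevel_spec (hX : IsContProcess X) (hcont : Continuous (marginDF P₀ X)) {q : ℝ}
    (hq0 : 0 < q) (hq1 : q < 1) : marginDF P₀ X (upperLevel (marginDF P₀ X) q) = q ∧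
      ∀ x, marginDF P₀ X x ≤ q ↔ x ≤ upperLevel (marginDF P₀ X) q := by
  set F := marginDF P₀ X with hF
  have hF' := marginDF_eq_cdf (P₀ := P₀) hX
  have hmono : Monotone F := by rw [hF, hF']; exact monotone_cdf _
  have htop : Tendsto F atTop (𝓝 1) := by rw [hF, hF']; exact tendsto_cdf_atTop _
  have hbot : Tendsto F atBot (𝓝 0) := by rw [hF, hF']; exact tendsto_cdf_atBot _
  obtain ⟨a, ha⟩ := (hbot.eventually_lt_const hq0).exists
  obtain ⟨b, hb⟩ := (htop.eventually_const_lt hq1).exists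
  have hne : {x | F x ≤ q}.Nonempty := ⟨a, ha.le⟩
  have hbdd : BddAbove {x | F x ≤ q} := by
    refine ⟨b, fun x hx => ?_⟩
    by_contra h
    push Not at h
    have h1 := hmono h.le
    have h2 : F x ≤ q := hx
    linarith
  have hmem : F (upperLevel F q) ≤ q :=
    (isClosed_le hcont continuous_const).csSup_mem hne hbdd
  refine ⟨le_antisymm hmem ?_, fun x => ⟨fun h => le_csSup hbdd h, fun h => (hmono h).trans hmem⟩⟩
  obtain ⟨z, hz⟩ := mem_range_of_exists_le_of_exists_ge hcont ⟨a, ha.le⟩ ⟨b, hb.le⟩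
  exact hz.symm.le.trans (hmono (le_csSup hbdd hz.le))

theorem upperLevel_mono (hX : IsContProcess X) (hcont : Continuous (marginDF P₀ X)) {q r : ℝ}
    (hq0 : 0 < q) (hqr : q ≤ r) (hr1 : r < 1) :
    upperLevel (marginDF P₀ X) q ≤ upperLevel (marginDF P₀ X) r := by
  rw [← (upperLevel_spec hX hcont (hq0.trans_le hqr) hr1).2,
    (upperLevel_spec hX hcont hq0 (hqr.trans_lt hr1)).1]
  exact hqr

theorem map_real_time_zero_gt (hX : IsContProcess X) (hcont : Continuous (marginDF P₀ X)) {u : ℝ}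
    (hu0 : 0 < u) (hu1 : u < 1) :
    (P₀.map X).real {x | upperLevel (marginDF P₀ X) (1 - u) < x 0} = u := by
  have hm : MeasurableSet {ω | X ω 0 ≤ upperLevel (marginDF P₀ X) (1 - u)} :=
    measurableSet_le (hX.measurable_coord 0) measurable_const
  rw [map_measureReal_apply hX.measurable
    (measurableSet_lt measurable_const (measurable_pi_apply _))]
  have : X ⁻¹' {x | upperLevel (marginDF P₀ X) (1 - u) < x 0} =
      {ω | X ω 0 ≤ upperLevel (marginDF P₀ X) (1 - u)}ᶜ := by
    ext ω; simp
  rw [this, probReal_compl_eq_one_sub hm]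
  have := (upperLevel_spec hX hcont (q := 1 - u) (by linarith) (by linarith)).1
  rw [marginDF] at this
  linarith

theorem map_real_exceed (hX : IsContProcess X) (hcont : Continuous (marginDF P₀ X)) {u : ℝ}
    (hu0 : 0 < u) (hu1 : u < 1) :
    (P₀.map X).real (exceed (upperLevel (marginDF P₀ X) (1 - u))) =
      1 - P₀.real {ω | ∀ t, copulaProcess P₀ X ω t ≤ 1 - u} := by
  rw [map_measureReal_apply hX.measurable (measurableSet_exceed _)]
  have hm := hX.measurable (measurableSet_exceed (upperLevel (marginDF P₀ X) (1 - u)))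
  have : {ω | ∀ t, copulaProcess P₀ X ω t ≤ 1 - u} =
      (X ⁻¹' exceed (upperLevel (marginDF P₀ X) (1 - u)))ᶜ := by
    ext ω
    rw [Set.mem_compl_iff, Set.mem_preimage, mem_exceed_iff (hX.continuous_path ω)]
    push Not
    exact forall_congr' fun t =>
      (upperLevel_spec hX hcont (q := 1 - u) (by linarith) (by linarith)).2 _
  rw [this, probReal_compl_eq_one_sub hm]
  ring

end Level

/-! ### Tail of the maximum from the generalized Pareto neighborhood. -/

section Tail

variable {Ω₁ Ω₂ : Type*} [MeasurableSpace Ω₁] [MeasurableSpace Ω₂] {P₁ : Measure Ω₁}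
  {P₂ : Measure Ω₂} {V : Ω₁ → unitInterval → ℝ} {Z : Ω₂ → unitInterval → ℝ}

theorem const_mem_bddFinDiscontNonpos {a : ℝ} (ha : a ≤ 0) :
    (fun _ => a) ∈ bddFinDiscontNonpos := by
  refine ⟨⟨⟨|a|, fun _ => le_rfl⟩, ?_⟩, fun _ => ha⟩
  have : {t : unitInterval | ¬ContinuousAt (fun _ => a) t} = ∅ := by
    ext t; simp [continuousAt_const]
  rw [this]
  exact Set.finite_empty

theorem dNorm_const (Q : Measure Ω₂) (Z : Ω₂ → unitInterval → ℝ) (a : ℝ) :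
    dNorm Q Z (fun _ => a) = |a| * dNorm Q Z fun _ => 1 := by
  simp only [dNorm]
  rw [← integral_const_mul]
  simp_rw [Real.mul_iSup_of_nonneg (abs_nonneg a), abs_one, one_mul]

/-- Compare 1 - u‖1‖_D = P(V ≤ 1 - u) with P(V_0 ≤ 1 - u) = 1 - u. In particular the normalizing
constant D is positive. -/
theorem IsGPCP.one_le_dNorm [IsProbabilityMeasure P₁] (hV : IsGPCP P₁ V P₂ Z) :
    1 ≤ dNorm P₂ Z fun _ => 1 := by
  obtain ⟨ε, hε, h⟩ := hV.upper_tail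
  set u := min ε (1 / 2) with hu
  have hu0 : 0 < u := lt_min hε (by norm_num)
  have hu1 : u ≤ 1 / 2 := min_le_right _ _
  have h1 := h (fun _ => -u) (const_mem_bddFinDiscontNonpos (by linarith)) fun _ => by
    rw [abs_neg, abs_of_pos hu0]; exact min_le_left _ _
  rw [dNorm_const, abs_neg, abs_of_pos hu0] at h1
  have h2 : P₁.real {ω | ∀ t, V ω t ≤ 1 + -u} ≤ P₁.real {ω | V ω 0 ≤ 1 - u} :=
    measureReal_mono fun ω hω => by
      have := hω 0
      simp only [Set.mem_ofPred_eq]; linarith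
  have h3 : P₁.real {ω | V ω 0 ≤ 1 - u} = 1 - u := by
    have hm : MeasurableSet {x : ℝ | x ≤ 1 - u} := measurableSet_Iic
    rw [(hV.uniform 0).measureReal_eq (p := fun x => x ≤ 1 - u) hm, measureReal_restrict_apply hm]
    have : {x : ℝ | x ≤ 1 - u} ∩ Set.Ioo 0 1 = Set.Ioc 0 (1 - u) := by
      ext x
      simp only [Set.mem_inter_iff, Set.mem_ofPred_eq, Set.mem_Ioo, Set.mem_Ioc]
      constructor
      · rintro ⟨h1, h2, _⟩; exact ⟨h2, h1⟩
      · rintro ⟨h1, h2⟩; exact ⟨h2, h1, by linarith⟩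
    rw [this, measureReal_def, Real.volume_Ioc, ENNReal.toReal_ofReal (by linarith)]
    ring
  have h4 : u * 1 ≤ u * dNorm P₂ Z fun _ => 1 := by linarith
  exact le_of_mul_le_mul_left h4 hu0

/-- The neighborhood condition at f = -1, with D = ‖1‖_D by homogeneity. This is all that the
argument takes from the GPCP. -/
theorem exists_exceed_tail_bound [IsProbabilityMeasure P₁] {Ω₀ : Type*} [MeasurableSpace Ω₀]
    {P₀ : Measure Ω₀} [IsProbabilityMeasure P₀] {X : Ω₀ → unitInterval → ℝ}
    (hX : IsContProcess X) (hcont : Continuous (marginDF P₀ X)) (hV : IsGPCP P₁ V P₂ Z) {δ : ℝ}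
    (hU : InDeltaNeighborhood P₀ (copulaProcess P₀ X) P₁ V δ) :
    ∃ D K u₀ : ℝ, 0 < D ∧ 0 < K ∧ 0 < u₀ ∧ u₀ < 1 ∧ ∀ u, 0 < u → u < u₀ →
      |(P₀.map X).real (exceed (upperLevel (marginDF P₀ X) (1 - u))) - D * u| ≤
        K * u ^ (1 + δ) := by
  obtain ⟨K, hK, hO⟩ := (hU (fun _ => -1) (const_mem_bddFinDiscontNonpos (by norm_num))).exists_pos
  obtain ⟨ε, hε, h⟩ := hV.upper_tail
  obtain ⟨r, hr, hr'⟩ := mem_nhdsGT_iff_exists_Ioo_subset.1 hO.bound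
  refine ⟨dNorm P₂ Z fun _ => 1, K, min r (min ε (1 / 2)), by linarith [hV.one_le_dNorm], hK,
    lt_min hr (lt_min hε (by norm_num)), ?_, fun u hu0 hu => ?_⟩
  · exact ((min_le_right _ _).trans (min_le_right _ _)).trans_lt (by norm_num)
  have hur : u < r := hu.trans_le (min_le_left _ _)
  have huε : u < ε := hu.trans_le ((min_le_right _ _).trans (min_le_left _ _))
  have hu2 : u < 1 / 2 := hu.trans_le ((min_le_right _ _).trans (min_le_right _ _))
  have h1 := hr' ⟨hu0, hur⟩
  have h2 := h (fun _ => u * -1) (const_mem_bddFinDiscontNonpos (by linarith)) fun _ => by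
    rw [mul_neg_one, abs_neg, abs_of_pos hu0]; exact huε.le
  rw [dNorm_const, mul_neg_one, abs_neg, abs_of_pos hu0] at h2
  simp only [Set.mem_ofPred_eq, mul_neg_one, h2, Real.norm_eq_abs,
    abs_of_pos (Real.rpow_pos_of_pos hu0 _)] at h1
  rw [map_real_exceed hX hcont hu0 (by linarith), ← abs_neg]
  refine le_of_eq_of_le (congrArg _ ?_) h1
  simp only [sub_eq_add_neg]
  ring

end Tail

/-! ### Convergence in probability to constants. -/

section ConvergenceInMeasure

variable {Ω : Type*} [MeasurableSpace Ω] {P : Measure Ω} [IsProbabilityMeasure P]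

/-- Continuous mapping for families of random variables that converge in probability to
constants. -/
theorem tendstoInMeasure_comp_of_continuousAt {ι E : Type*} [PseudoMetricSpace E]
    {X : ι → ℕ → Ω → ℝ} {a : ι → ℝ} (hX : ∀ i, TendstoInMeasure P (X i) atTop fun _ => a i)
    {g : (ι → ℝ) → E} (hg : ContinuousAt g a) :
    TendstoInMeasure P (fun n ω => g fun i => X i n ω) atTop fun _ => g a := by
  rw [tendstoInMeasure_iff_measureReal_dist]
  intro ε hε
  have hnb : g ⁻¹' Metric.ball (g a) ε ∈ 𝓝 a := hg (Metric.ball_mem_nhds _ hε)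
  -- A product neighborhood restricts finitely many coordinates, so a finite union bound suffices
  -- even for infinite families.
  rw [nhds_pi, Filter.mem_pi] at hnb
  obtain ⟨I, hI, t, ht, hsub⟩ := hnb
  choose r hr hrt using fun i => Metric.mem_nhds_iff.1 (ht i)
  have hlim : Tendsto (fun n => ∑ i ∈ hI.toFinset, P.real {ω | r i ≤ dist (X i n ω) (a i)}) atTop
      (𝓝 0) := by
    have := tendsto_finsetSum hI.toFinset fun i _ =>
      (tendstoInMeasure_iff_measureReal_dist.1 (hX i)) (r i) (hr i)
    simpa using this
  refine squeeze_zero (fun _ => measureReal_nonneg) (fun n => ?_) hlim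
  refine (measureReal_mono ?_ (measure_ne_top _ _)).trans (measureReal_biUnion_finset_le hI.toFinset fun i =>
    {ω | r i ≤ dist (X i n ω) (a i)})
  intro ω hω
  by_contra hcon
  simp only [Set.mem_iUnion, not_exists] at hcon
  have hmem : (fun i => X i n ω) ∈ I.pi t := fun i hi => hrt i (by
    have h : ¬ r i ≤ dist (X i n ω) (a i) := hcon i (hI.mem_toFinset.2 hi)
    exact not_le.1 h)
  have h1 : dist (g fun i => X i n ω) (g a) < ε := hsub hmem
  exact absurd hω (not_le.2 h1)

theorem tendstoInMeasure_of_tendsto_const {a : ℕ → ℝ} {b : ℝ} (h : Tendsto a atTop (𝓝 b)) :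
    TendstoInMeasure P (fun n _ => a n) atTop fun _ => b :=
  tendstoInMeasure_of_tendsto_ae (fun _ => aestronglyMeasurable_const)
    (Eventually.of_forall fun _ => h)

end ConvergenceInMeasure

/-! ### Empirical versus true levels: bounds for fixed n. -/

section RandomLevel

variable {Ω Ω₀ : Type*} [MeasurableSpace Ω] [MeasurableSpace Ω₀] {P : Measure Ω}
  [IsProbabilityMeasure P] {P₀ : Measure Ω₀} [IsProbabilityMeasure P₀]
  {X : Ω₀ → unitInterval → ℝ} {Xs : ℕ → Ω → unitInterval → ℝ}

/-- The empirical quantile lies between neighboring true quantiles with high probability. -/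
theorem measureReal_genInv_notMem_Icc_le (hX : IsContProcess X)
    (hcont : Continuous (marginDF P₀ X)) (hindep : iIndepFun Xs P)
    (hlaw : ∀ i, HasLaw (Xs i) (P₀.map X) P) {n : ℕ} (hn : 0 < n) {u h : ℝ} (hh : 0 < h)
    (hhu : h < u) (hu : u + h < 1) :
    P.real {ω | genInv (empDF n fun i => Xs i ω) (1 - u) ∉
      Set.Icc (upperLevel (marginDF P₀ X) (1 - (u + h)))
        (upperLevel (marginDF P₀ X) (1 - (u - h)))} ≤ 2 * u / (n * h ^ 2) := by
  have hn' : (0 : ℝ) < n := by exact_mod_cast hn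
  have hA : ∀ y : ℝ, MeasurableSet {x : unitInterval → ℝ | y < x 0} := fun y =>
    measurableSet_lt measurable_const (measurable_pi_apply _)
  have cheb := fun (v : ℝ) (hv0 : 0 < v) (hv1 : v < 1) => by
    have := measureReal_le_abs_countIn_sub_le hindep hlaw (Finset.range n)
      (hA (upperLevel (marginDF P₀ X) (1 - v))) (mul_pos hn' hh)
    rwa [map_real_time_zero_gt hX hcont hv0 hv1, Finset.card_range] at this
  have h1 := cheb (u + h) (by linarith) hu
  have h2 := cheb (u - h) (by linarith) (by linarith)
  refine (measureReal_mono ?_).trans ((measureReal_union_le _ _).trans ((add_le_add h1 h2).trans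
    (le_of_eq ?_)))
  -- If both counts deviate from their means by less than nh, the empirical distribution function is
  -- below 1 - u at the lower level and above it at the upper one.
  · intro ω hω
    by_contra hcon
    rw [Set.mem_union, not_or] at hcon
    obtain ⟨hc1, hc2⟩ := hcon
    simp only [Set.mem_ofPred_eq, not_le, countIn_time_zero_gt hn, ← mul_sub, abs_mul,
      abs_of_pos hn', mul_lt_mul_iff_right₀ hn', abs_lt] at hc1 hc2
    refine hω ⟨le_genInv_empDF hn _ (by linarith) (by linarith [hc1.1]),
      genInv_empDF_le _ (by linarith) (by linarith [hc2.2])⟩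
  · field_simp
    ring

/-- Either the empirical quantile leaves the bracket, or at least ε counted paths lie between its
ends, which Markov's inequality controls. The union bound needs no independence between quantile and
counts. -/
theorem measureReal_le_abs_countIn_genInv_sub_le (hX : IsContProcess X)
    (hcont : Continuous (marginDF P₀ X)) (hindep : iIndepFun Xs P)
    (hlaw : ∀ i, HasLaw (Xs i) (P₀.map X) P) {n : ℕ} (hn : 0 < n) (M : Finset ℕ) {u h ε : ℝ}
    (hh : 0 < h) (hhu : h < u) (hu : u + h < 1) (hε : 0 < ε) :
    P.real {ω | ε ≤ |countIn M (exceed (genInv (empDF n fun i => Xs i ω) (1 - u)))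
        (fun i => Xs i ω) - countIn M (exceed (upperLevel (marginDF P₀ X) (1 - u)))
        fun i => Xs i ω|} ≤
      2 * u / (n * h ^ 2) +
        M.card * ((P₀.map X).real (exceed (upperLevel (marginDF P₀ X) (1 - (u + h)))) -
          (P₀.map X).real (exceed (upperLevel (marginDF P₀ X) (1 - (u - h))))) / ε := by
  have : IsProbabilityMeasure (P₀.map X) := Measure.isProbabilityMeasure_map
    hX.measurable.aemeasurable
  set a := upperLevel (marginDF P₀ X) (1 - (u + h)) with ha
  set b := upperLevel (marginDF P₀ X) (1 - (u - h)) with hb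
  set y := upperLevel (marginDF P₀ X) (1 - u) with hy
  have hay : a ≤ y := upperLevel_mono hX hcont (by linarith) (by linarith) (by linarith)
  have hyb : y ≤ b := upperLevel_mono hX hcont (by linarith) (by linarith) (by linarith)
  have hdiff : (P₀.map X).real (exceed a \ exceed b) =
      (P₀.map X).real (exceed a) - (P₀.map X).real (exceed b) :=
    measureReal_sdiff (antitone_exceed (hay.trans hyb)) (measurableSet_exceed b)
  have h1 := measureReal_genInv_notMem_Icc_le hX hcont hindep hlaw hn hh hhu hu
  have h2 := measureReal_le_countIn_le hlaw M
    ((measurableSet_exceed a).diff (measurableSet_exceed b)) hε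
  rw [hdiff] at h2
  refine (measureReal_mono ?_).trans ((measureReal_union_le _ _).trans (add_le_add h1 h2))
  intro ω hω
  by_cases hg : genInv (empDF n fun i => Xs i ω) (1 - u) ∈ Set.Icc a b
  · right
    have hω' : ε ≤ |_| := hω
    exact hω'.trans (abs_countIn_exceed_sub_le M _ hg.1 hg.2 hay hyb)
  · left
    exact hg

end RandomLevel

/-! ### Rates for the bias. -/

section Rates

variable {m : ℕ → ℝ} {c : ℕ → ℝ} {δ D : ℝ}

/-- The quotient equals √(m c^(1+2δ)) / √D, which explains the exponent 1 + 2δ. -/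
theorem tendsto_mul_rpow_div_sqrt (hm : ∀ n, 0 ≤ m n) (hc : ∀ n, 0 < c n)
    (hmc : Tendsto (fun n => m n * c n) atTop atTop)
    (hmcδ : Tendsto (fun n => m n * c n ^ (1 + 2 * δ)) atTop (𝓝 0)) (hD : 0 < D) :
    Tendsto (fun n => m n * c n ^ (1 + δ) / √(m n * c n * D)) atTop (𝓝 0) := by
  have h := ((Real.continuous_sqrt.tendsto _).comp hmcδ).div_const √D
  rw [Real.sqrt_zero, zero_div] at h
  refine h.congr' ?_
  filter_upwards [hmc.eventually_gt_atTop 0] with n hn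
  have h1 : m n * c n ^ (1 + δ) = √(m n * c n ^ (1 + 2 * δ)) * √(m n * c n) := by
    have hp : 0 ≤ c n ^ (1 + 2 * δ) := Real.rpow_nonneg (hc n).le _
    rw [← Real.sqrt_mul (mul_nonneg (hm n) hp), eq_comm, Real.sqrt_eq_iff_mul_self_eq
      (mul_nonneg (mul_nonneg (hm n) hp) hn.le)
      (mul_nonneg (hm n) (Real.rpow_nonneg (hc n).le _))]
    have h2 : c n ^ (1 + δ) * c n ^ (1 + δ) = c n ^ (1 + 2 * δ) * c n := by
      rw [← Real.rpow_add (hc n), ← Real.rpow_add_one (hc n).ne']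
      ring_nf
    linear_combination -(m n ^ 2) * h2
  have h3 : √(m n * c n) ≠ 0 := (Real.sqrt_pos.2 hn).ne'
  have h4 : √D ≠ 0 := (Real.sqrt_pos.2 hD).ne'
  rw [Function.comp, h1, Real.sqrt_mul hn.le]
  field_simp

variable {G : ℝ → ℝ} {K u₀ : ℝ}

theorem tendsto_tail_div (hc : ∀ n, 0 < c n) (hc0 : Tendsto c atTop (𝓝 0)) (hδ : 0 < δ)
    (hK : 0 < K) (hu₀ : 0 < u₀) (hG : ∀ u, 0 < u → u < u₀ → |G u - D * u| ≤ K * u ^ (1 + δ))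
    (j : ℕ) : Tendsto (fun n => G (c n / (j + 1)) / c n) atTop (𝓝 (D / (j + 1))) := by
  have hlim : Tendsto (fun n => K * c n ^ δ) atTop (𝓝 0) := by
    have := (hc0.rpow_const (p := δ) (Or.inr hδ.le)).const_mul K
    rwa [Real.zero_rpow hδ.ne', mul_zero] at this
  rw [tendsto_iff_norm_sub_tendsto_zero]
  refine squeeze_zero' (Eventually.of_forall fun n => norm_nonneg _) ?_ hlim
  filter_upwards [hc0.eventually_lt_const hu₀] with n hn
  have hj : (0 : ℝ) < j + 1 := by positivity
  have hle : c n / (j + 1) ≤ c n := div_le_self (hc n).le (by linarith [Nat.cast_nonneg (α := ℝ) j])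
  have h1 := hG (c n / (j + 1)) (div_pos (hc n) hj) (hle.trans_lt hn)
  have h2 : (c n / (j + 1)) ^ (1 + δ) ≤ c n ^ (1 + δ) :=
    Real.rpow_le_rpow (div_pos (hc n) hj).le hle (by linarith)
  have h3 : G (c n / (j + 1)) / c n - D / (j + 1) =
      (G (c n / (j + 1)) - D * (c n / (j + 1))) / c n := by
    have := (hc n).ne'
    field_simp
  rw [h3, Real.norm_eq_abs, abs_div, abs_of_pos (hc n), div_le_iff₀ (hc n), mul_assoc,
    ← Real.rpow_add_one (hc n).ne', add_comm δ 1]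
  exact h1.trans (mul_le_mul_of_nonneg_left h2 hK.le)

theorem tendsto_tail_bias (hm : ∀ n, 0 ≤ m n) (hc : ∀ n, 0 < c n) (hc0 : Tendsto c atTop (𝓝 0))
    (hδ : 0 < δ) (hmc : Tendsto (fun n => m n * c n) atTop atTop)
    (hmcδ : Tendsto (fun n => m n * c n ^ (1 + 2 * δ)) atTop (𝓝 0)) (hD : 0 < D)
    (hK : 0 < K) (hu₀ : 0 < u₀) (hG : ∀ u, 0 < u → u < u₀ → |G u - D * u| ≤ K * u ^ (1 + δ))
    (j : ℕ) : Tendsto (fun n => m n * (((j : ℝ) + 1) * G (c n / (j + 1)) - D * c n) /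
      √(m n * c n * D)) atTop (𝓝 0) := by
  have hlim := (tendsto_mul_rpow_div_sqrt hm hc hmc hmcδ hD).const_mul (((j : ℝ) + 1) * K)
  rw [mul_zero] at hlim
  refine squeeze_zero_norm' ?_ hlim
  filter_upwards [hc0.eventually_lt_const hu₀] with n hn
  have hj : (0 : ℝ) < j + 1 := by positivity
  have hle : c n / (j + 1) ≤ c n := div_le_self (hc n).le (by linarith [Nat.cast_nonneg (α := ℝ) j])
  have h1 := hG (c n / (j + 1)) (div_pos (hc n) hj) (hle.trans_lt hn)
  have h2 : (c n / (j + 1)) ^ (1 + δ) ≤ c n ^ (1 + δ) :=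
    Real.rpow_le_rpow (div_pos (hc n) hj).le hle (by linarith)
  have h3 : m n * (((j : ℝ) + 1) * G (c n / (j + 1)) - D * c n) =
      m n * ((j + 1) * (G (c n / (j + 1)) - D * (c n / (j + 1)))) := by
    field_simp
  have h4 : |G (c n / (j + 1)) - D * (c n / (j + 1))| ≤ K * c n ^ (1 + δ) :=
    h1.trans (mul_le_mul_of_nonneg_left h2 hK.le)
  rw [h3, Real.norm_eq_abs, abs_div, abs_of_nonneg (Real.sqrt_nonneg _), abs_mul, abs_mul,
    abs_of_nonneg (hm n), abs_of_pos hj, ← mul_div_assoc (_ * K)]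
  refine div_le_div_of_nonneg_right ?_ (Real.sqrt_nonneg _)
  calc m n * ((j + 1) * |G (c n / (j + 1)) - D * (c n / (j + 1))|)
      ≤ m n * ((j + 1) * (K * c n ^ (1 + δ))) :=
        mul_le_mul_of_nonneg_left (mul_le_mul_of_nonneg_left h4 hj.le) (hm n)
    _ = _ := by ring

end Rates

theorem tendsto_div_of_tendsto_mul_log_div {m : ℕ → ℕ} (hm : Tendsto m atTop atTop)
    (h : Tendsto (fun n => (m n : ℝ) * Real.log (m n) / n) atTop (𝓝 0)) :
    Tendsto (fun n => (m n : ℝ) / n) atTop (𝓝 0) := by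
  refine squeeze_zero' (Eventually.of_forall fun n => by positivity) ?_ h
  have hlog := (Real.tendsto_log_atTop.comp (tendsto_natCast_atTop_atTop.comp hm)).eventually_ge_atTop
    (1 : ℝ)
  filter_upwards [hlog] with n hn
  exact div_le_div_of_nonneg_right (le_mul_of_one_le_right (Nat.cast_nonneg _) hn)
    (Nat.cast_nonneg _)

/-! ### Empirical versus true levels: the limit. -/

section RandomLevelLimit

variable {Ω Ω₀ : Type*} [MeasurableSpace Ω] [MeasurableSpace Ω₀] {P : Measure Ω}
  [IsProbabilityMeasure P] {P₀ : Measure Ω₀} [IsProbabilityMeasure P₀]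
  {X : Ω₀ → unitInterval → ℝ} {Xs : ℕ → Ω → unitInterval → ℝ} {M : ℕ → Finset ℕ} {c : ℕ → ℝ}
  {δ D K u₀ : ℝ}

/-- Replacing the true quantile by the empirical one changes the counts by `o_P(√(m c))`. -/
theorem tendstoInMeasure_nHat_sub_countIn (hX : IsContProcess X)
    (hcont : Continuous (marginDF P₀ X)) (hXs : ∀ i, IsContProcess (Xs i))
    (hindep : iIndepFun Xs P) (hlaw : ∀ i, HasLaw (Xs i) (P₀.map X) P)
    (hc : ∀ n, 0 < c n) (hc0 : Tendsto c atTop (𝓝 0)) (hδ : 0 < δ)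
    (hmn : Tendsto (fun n => ((M n).card : ℝ) / n) atTop (𝓝 0))
    (hmc : Tendsto (fun n => ((M n).card : ℝ) * c n) atTop atTop)
    (hmcδ : Tendsto (fun n => ((M n).card : ℝ) * c n ^ (1 + 2 * δ)) atTop (𝓝 0)) (hD : 0 < D)
    (hK : 0 < K) (hu₀ : 0 < u₀) (hu₁ : u₀ < 1)
    (hG : ∀ u, 0 < u → u < u₀ →
      |(P₀.map X).real (exceed (upperLevel (marginDF P₀ X) (1 - u))) - D * u| ≤ K * u ^ (1 + δ))
    (j : ℕ) : TendstoInMeasure P (fun n ω => (nHat n (M n) (fun i => Xs i ω) (c n) (j + 1 : ℕ) -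
      countIn (M n) (exceed (upperLevel (marginDF P₀ X) (1 - c n / (j + 1)))) fun i => Xs i ω) /
      √((M n).card * c n * D)) atTop fun _ => 0 := by
  set m : ℕ → ℝ := fun n => ((M n).card : ℝ) with hm
  set S : ℕ → ℝ := fun n => √(m n * c n * D) with hS
  set ρ : ℕ → ℝ := fun n => m n / n with hρ
  have hm0 : ∀ n, 0 ≤ m n := fun n => Nat.cast_nonneg _
  have hj : (0 : ℝ) < j + 1 := by positivity
  rw [tendstoInMeasure_iff_measureReal_norm]
  intro ε hε
  have hsρ : Tendsto (fun n => √(ρ n)) atTop (𝓝 0) := by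
    have := (Real.continuous_sqrt.tendsto _).comp hmn
    rwa [Real.sqrt_zero] at this
  have hssρ : Tendsto (fun n => √√(ρ n)) atTop (𝓝 0) := by
    have := (Real.continuous_sqrt.tendsto _).comp hsρ
    rwa [Real.sqrt_zero] at this
  have hr := tendsto_mul_rpow_div_sqrt hm0 hc hmc hmcδ hD
  have hlim : Tendsto (fun n => 2 * (j + 1) * √(ρ n) + (2 * D / √D * √√(ρ n) +
      2 * K * 2 ^ (1 + δ) * (m n * c n ^ (1 + δ) / S n)) / ε) atTop (𝓝 0) := by
    have := (hsρ.const_mul (2 * ((j : ℝ) + 1))).add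
      (((hssρ.const_mul (2 * D / √D)).add (hr.const_mul (2 * K * 2 ^ (1 + δ)))).div_const ε)
    simpa using this
  refine squeeze_zero' (Eventually.of_forall fun n => measureReal_nonneg) ?_ hlim
  filter_upwards [hmc.eventually_gt_atTop 1, hmn.eventually_lt_const one_pos,
    hc0.eventually_lt_const (half_pos hu₀), eventually_gt_atTop 0] with n hmc1 hmn1 hcu hn
  have hn' : (0 : ℝ) < n := by exact_mod_cast hn
  have hcn := hc n
  have hmpos : 0 < m n := by
    by_contra h
    have : m n = 0 := le_antisymm (not_lt.1 h) (hm0 n)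
    rw [hm] at this
    simp only at this
    rw [this] at hmc1
    linarith
  have hρpos : 0 < ρ n := div_pos hmpos hn'
  have hsρpos : 0 < √(ρ n) := Real.sqrt_pos.2 hρpos
  have hsρ1 : √(ρ n) ≤ 1 := Real.sqrt_le_one.2 hmn1.le
  set η : ℝ := √(c n / m n * √(ρ n)) with hη
  have hη2 : η ^ 2 = c n / m n * √(ρ n) := Real.sq_sqrt (by positivity)
  have hη0 : 0 < η := Real.sqrt_pos.2 (by positivity)
  have hηc : η < c n := by
    refine lt_of_pow_lt_pow_left₀ 2 hcn.le ?_
    rw [hη2]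
    calc c n / m n * √(ρ n) ≤ c n / m n * 1 := mul_le_mul_of_nonneg_left hsρ1 (by positivity)
      _ < c n ^ 2 := by
        rw [mul_one, div_lt_iff₀ hmpos]
        have : c n * 1 < c n * (m n * c n) := mul_lt_mul_of_pos_left hmc1 hcn
        linarith
  set u : ℝ := c n / (j + 1) with hu
  set h : ℝ := η / (j + 1) with hh
  have hu0 : 0 < u := by positivity
  have hh0 : 0 < h := by positivity
  have hhu : h < u := div_lt_div_of_pos_right hηc hj
  have huc : u ≤ c n := div_le_self hcn.le (by linarith [Nat.cast_nonneg (α := ℝ) j])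
  have hhη : h ≤ η := div_le_self hη0.le (by linarith [Nat.cast_nonneg (α := ℝ) j])
  have hSpos : 0 < S n := Real.sqrt_pos.2 (by positivity)
  have hmain := measureReal_le_abs_countIn_genInv_sub_le hX hcont hindep hlaw hn (M n) hh0 hhu
    (by linarith) (mul_pos hε hSpos)
  have hset : {ω | ε ≤ ‖(nHat n (M n) (fun i => Xs i ω) (c n) (j + 1 : ℕ) -
      countIn (M n) (exceed (upperLevel (marginDF P₀ X) (1 - u))) fun i => Xs i ω) / S n - 0‖} =
      {ω | ε * S n ≤ |countIn (M n) (exceed (genInv (empDF n fun i => Xs i ω) (1 - u)))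
        (fun i => Xs i ω) - countIn (M n) (exceed (upperLevel (marginDF P₀ X) (1 - u)))
        fun i => Xs i ω|} := by
    ext ω
    rw [Set.mem_ofPred_eq, Set.mem_ofPred_eq, nHat_eq_countIn fun i => (hXs i).continuous_path ω,
      sub_zero, Real.norm_eq_abs, abs_div, abs_of_pos hSpos, le_div_iff₀ hSpos]
    push_cast
    rfl
  rw [hset]
  refine hmain.trans (add_le_add (le_of_eq ?_) ?_)
  · have hnm : m n = ρ n * n := by rw [hρ]; field_simp
    have hsq : ρ n = √(ρ n) * √(ρ n) := (Real.mul_self_sqrt hρpos.le).symm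
    rw [hh, div_pow, hη2, hu, hnm]
    generalize √(ρ n) = s at *
    rw [hsq]
    field_simp
  · have hle : ∀ v, 0 < v → v ≤ 2 * c n →
        |(P₀.map X).real (exceed (upperLevel (marginDF P₀ X) (1 - v))) - D * v| ≤
          K * (2 ^ (1 + δ) * c n ^ (1 + δ)) := by
      intro v hv0 hv
      refine (hG v hv0 (by linarith)).trans (mul_le_mul_of_nonneg_left ?_ hK.le)
      rw [← Real.mul_rpow (by norm_num) hcn.le]
      exact Real.rpow_le_rpow hv0.le hv (by linarith)
    have h1 := (abs_le.1 (hle (u + h) (by linarith) (by linarith))).2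
    have h2 := (abs_le.1 (hle (u - h) (by linarith) (by linarith))).1
    have h3 : (P₀.map X).real (exceed (upperLevel (marginDF P₀ X) (1 - (u + h)))) -
        (P₀.map X).real (exceed (upperLevel (marginDF P₀ X) (1 - (u - h)))) ≤
        2 * D * η + 2 * K * (2 ^ (1 + δ) * c n ^ (1 + δ)) := by
      have : D * h ≤ D * η := mul_le_mul_of_nonneg_left hhη hD.le
      linarith
    have hηS : m n * η / S n = √√(ρ n) / √D := by
      have e1 : S n = √(m n * c n) * √D := by rw [hS]; exact Real.sqrt_mul (by positivity) _
      have e2 : m n * η = √(m n * c n) * √√(ρ n) := by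
        rw [hη, ← Real.sqrt_mul (by positivity), eq_comm, Real.sqrt_eq_iff_mul_self_eq
          (by positivity) (by positivity)]
        rw [mul_mul_mul_comm, Real.mul_self_sqrt (by positivity)]
        field_simp
      have hx : √(m n * c n) ≠ 0 := (Real.sqrt_pos.2 (by positivity)).ne'
      rw [e1, e2, mul_div_mul_left _ _ hx]
    have h4 : m n * (2 * D * η + 2 * K * (2 ^ (1 + δ) * c n ^ (1 + δ))) / (ε * S n) =
        (2 * D * (m n * η / S n) + 2 * K * 2 ^ (1 + δ) * (m n * c n ^ (1 + δ) / S n)) / ε := by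
      have := hSpos.ne'
      field_simp
    rw [hηS] at h4
    refine (div_le_div_of_nonneg_right (mul_le_mul_of_nonneg_left h3 (hm0 n))
      (by positivity)).trans (h4.le.trans (le_of_eq ?_))
    ring

end RandomLevelLimit

/-! ### The statistic in terms of transformed increments. -/

theorem sum_Icc_one_eq_sum_range {E : Type*} [AddCommMonoid E] (f : ℕ → E) (k : ℕ) :
    ∑ j ∈ Finset.Icc 1 k, f j = ∑ j ∈ Finset.range k, f (j + 1) := by
  have : Finset.Icc 1 k = Finset.Ico 1 (k + 1) := by ext; simp
  rw [this, Finset.sum_Ico_eq_sum_range]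
  simp [add_comm]

theorem nHatMean_eq_sum_range (k n : ℕ) (M : Finset ℕ) (x : ℕ → unitInterval → ℝ) (c : ℝ) :
    nHatMean k n M x c =
      1 / k * ∑ j ∈ Finset.range k, ((j : ℝ) + 1) * nHat n M x c (j + 1) := by
  rw [nHatMean, sum_Icc_one_eq_sum_range]
  push_cast
  rfl

/-- The test statistic in terms of the transformed increments of the standardized counts. -/
theorem tHat_eq_sum_transformedIncr {k : ℕ} (hk : 0 < k) (n : ℕ) (M : Finset ℕ)
    (x : ℕ → unitInterval → ℝ) (c : ℝ) {S : ℝ} (hS : S ≠ 0) :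
    tHat k n M x c = (∑ i : Fin (k - 1), limitWeight k (i + 1) *
      transformedIncr k S (fun j => nHat n M x c (j + 1)) i ^ 2) * (nHatMean k n M x c / S ^ 2)⁻¹ := by
  have h := sum_sq_sub_mean k hk fun j => ((j : ℝ) + 1) * nHat n M x c (j + 1) / S
  rw [← Fin.sum_univ_eq_sum_range (fun i => limitWeight k (i + 1) *
    (∑ j ∈ Finset.range (k - 1), sinRow k (i + 1) (j + 1) *
      ((((j + 1 : ℕ) : ℝ) + 1) * nHat n M x c (j + 1 + 1) / S -
        ((j : ℝ) + 1) * nHat n M x c (j + 1) / S)) ^ 2)] at h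
  simp only [transformedIncr]
  rw [← h, tHat, sum_Icc_one_eq_sum_range, nHatMean_eq_sum_range, ← Finset.sum_div]
  have h2 : ∀ j : ℕ, ((j : ℝ) + 1) * nHat n M x c (j + 1) / S -
      1 / k * ((∑ j ∈ Finset.range k, ((j : ℝ) + 1) * nHat n M x c (j + 1)) / S) =
      (((j + 1 : ℕ) : ℝ) * nHat n M x c (j + 1) -
        1 / k * ∑ j ∈ Finset.range k, ((j : ℝ) + 1) * nHat n M x c (j + 1)) / S := by
    intro j; push_cast; ring
  simp_rw [h2, div_pow]
  rw [← Finset.sum_div, inv_div, div_mul_div_cancel₀ (pow_ne_zero 2 hS)]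

theorem transformedIncr_sub_div {k : ℕ} (S : ℝ) (N N' : ℕ → ℝ) (i : Fin (k - 1)) :
    transformedIncr k S N i - transformedIncr k S N' i =
      transformedIncr k 1 (fun j => (N j - N' j) / S) i := by
  simp only [transformedIncr]
  rw [← Finset.sum_sub_distrib]
  refine Finset.sum_congr rfl fun j _ => ?_
  ring

theorem toLp_transformedIncr_sub (k : ℕ) (S : ℝ) (N N' : ℕ → ℝ) :
    (WithLp.toLp 2 fun i => transformedIncr k S N i : EuclideanSpace ℝ (Fin (k - 1))) -
      WithLp.toLp 2 (fun i => transformedIncr k S N' i) =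
      WithLp.toLp 2 fun i => transformedIncr k 1 (fun j => (N j - N' j) / S) i := by
  ext i
  exact transformedIncr_sub_div S N N' i

theorem continuous_transformedIncr (k : ℕ) :
    Continuous fun N : ℕ → ℝ => (WithLp.toLp 2 fun i => transformedIncr k 1 N i :
      EuclideanSpace ℝ (Fin (k - 1))) := by
  refine (PiLp.continuous_toLp 2 _).comp (continuous_pi fun i => ?_)
  simp only [transformedIncr]
  fun_prop

end

/-! ### Assembly. -/

theorem mainTheorem5
    {Ω₀ Ω Ω₁ Ω₂ Ω₃ : Type*} [MeasurableSpace Ω₀] [MeasurableSpace Ω] [MeasurableSpace Ω₁]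
    [MeasurableSpace Ω₂] [MeasurableSpace Ω₃]
    (P₀ : Measure Ω₀) [IsProbabilityMeasure P₀] (P : Measure Ω) [IsProbabilityMeasure P]
    (P₁ : Measure Ω₁) [IsProbabilityMeasure P₁] (P₂ : Measure Ω₂) [IsProbabilityMeasure P₂]
    (P₃ : Measure Ω₃) [IsProbabilityMeasure P₃]
    -- the process `X` in `C[0,1]` with identical continuous margins
    (X : Ω₀ → unitInterval → ℝ) (hX : IsContProcess X)
    (hident : ∀ (t : unitInterval) (x : ℝ), P₀.real {ω | X ω t ≤ x} = marginDF P₀ X x)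
    (hcont : Continuous (marginDF P₀ X))
    -- its copula process is in the `δ`-neighborhood of the GPCP `V`
    (V : Ω₁ → unitInterval → ℝ) (Z : Ω₂ → unitInterval → ℝ) (hV : IsGPCP P₁ V P₂ Z)
    (δ : ℝ) (hδ : 0 < δ)
    (hU : InDeltaNeighborhood P₀ (copulaProcess P₀ X) P₁ V δ)
    -- independent copies of `X`
    (Xs : ℕ → Ω → unitInterval → ℝ) (hXs : ∀ i, IsContProcess (Xs i))
    (hindep : iIndepFun Xs P) (hcopy : ∀ i, IdentDistrib (Xs i) X P P₀)
    -- the index sets and the rates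
    (k : ℕ) (hk : 2 ≤ k)
    (M : ℕ → Finset ℕ) (hM : ∀ n, M n ⊆ Finset.range n)
    (c : ℕ → ℝ) (hc_pos : ∀ n, 0 < c n)
    (hm : Tendsto (fun n => (M n).card) atTop atTop)
    (hmlog : Tendsto (fun n => ((M n).card : ℝ) * Real.log (M n).card / n) atTop (𝓝 0))
    (hc : Tendsto c atTop (𝓝 0))
    (hmc : Tendsto (fun n => ((M n).card : ℝ) * c n) atTop atTop)
    (hmcδ : Tendsto (fun n => ((M n).card : ℝ) * c n ^ (1 + 2 * δ)) atTop (𝓝 0))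
    -- independent standard normal random variables
    (ξ : Fin (k - 1) → Ω₃ → ℝ) (hξ : ∀ i, HasLaw (ξ i) (gaussianReal 0 1) P₃)
    (hξ_indep : iIndepFun ξ P₃) :
    TendstoInDistribution
      (fun n ω => tHat k n (M n) (fun i => Xs i ω) (c n)) atTop
      (fun ω => ∑ i : Fin (k - 1), limitWeight k ((i : ℕ) + 1) * ξ i ω ^ 2)
      (fun _ => P) P₃ := by
  have hμ : IsProbabilityMeasure (P₀.map X) := Measure.isProbabilityMeasure_map
    hX.measurable.aemeasurable
  have hlaw : ∀ i, HasLaw (Xs i) (P₀.map X) P := fun i =>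
    ⟨(hcopy i).aemeasurable_fst, (hcopy i).map_eq⟩
  have hk0 : 0 < k := by omega
  obtain ⟨D, K, u₀, hD, hK, hu₀, hu₁, hG⟩ := exists_exceed_tail_bound hX hcont hV hU
  have hmn := tendsto_div_of_tendsto_mul_log_div hm hmlog
  set B : ℕ → ℕ → Set (unitInterval → ℝ) := fun n j =>
    exceed (upperLevel (marginDF P₀ X) (1 - c n / (j + 1))) with hB
  set S : ℕ → ℝ := fun n => √((M n).card * c n * D) with hS
  have hSt : Tendsto S atTop atTop := Real.tendsto_sqrt_atTop.comp (hmc.atTop_mul_const hD)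
  have hp : ∀ j : ℕ, Tendsto (fun n => (P₀.map X).real (B n j) / c n) atTop
      (𝓝 (D / (j + 1))) := fun j => tendsto_tail_div
    (G := fun u => (P₀.map X).real (exceed (upperLevel (marginDF P₀ X) (1 - u))))
    hc_pos hc hδ hK hu₀ hG j
  -- Only eventually, because the levels are controlled once c < 1.
  have hanti : ∀ᶠ n in atTop, Antitone (B n) := by
    filter_upwards [hc.eventually_lt_const one_pos] with n hn i j hij
    have h1 : (i : ℝ) ≤ j := by exact_mod_cast hij
    have hi : (0 : ℝ) < i + 1 := by positivity
    have hj : (0 : ℝ) < j + 1 := by positivity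
    have h2 : c n / (j + 1) ≤ c n / (i + 1) :=
      div_le_div_of_nonneg_left (hc_pos n).le hi (by linarith)
    have h3 : c n / (i + 1) ≤ c n := div_le_self (hc_pos n).le
      (by linarith [Nat.cast_nonneg (α := ℝ) i])
    have h4 : 0 < c n / (j + 1) := div_pos (hc_pos n) hj
    exact antitone_exceed (upperLevel_mono hX hcont (by linarith) (by linarith) (by linarith))
  have hclt := tendstoInDistribution_transformedIncr hindep (fun i => (hXs i).measurable) hlaw hm
    (B := B) (fun n j => measurableSet_exceed _) hanti hD hc_pos hmc hp
    (fun j => tendsto_tail_bias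
      (G := fun u => (P₀.map X).real (exceed (upperLevel (marginDF P₀ X) (1 - u))))
      (fun n => Nat.cast_nonneg _) hc_pos hc hδ hmc hmcδ hD hK hu₀ hG j) hξ hξ_indep
  have herr := tendstoInMeasure_nHat_sub_countIn hX hcont hXs hindep hlaw hc_pos hc hδ hmn hmc hmcδ
    hD hK hu₀ hu₁ hG
  have hηm : ∀ n, AEMeasurable (fun ω => (WithLp.toLp 2 fun i => transformedIncr k (S n)
      (fun j => nHat n (M n) (fun i => Xs i ω) (c n) (j + 1)) i :
        EuclideanSpace ℝ (Fin (k - 1)))) P := by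
    intro n
    refine ((WithLp.measurable_toLp 2 _).comp (measurable_pi_lambda _ fun i => ?_)).aemeasurable
    have h := fun j => measurable_nHat hXs n (M n) (hc_pos n).le j
    exact Finset.measurable_fun_sum _ fun j _ => ((((h (j + 1 + 1)).const_mul _).div_const _).sub
      (((h (j + 1)).const_mul _).div_const _)).const_mul _
  have hvec : TendstoInDistribution (fun n ω => (WithLp.toLp 2 fun i => transformedIncr k (S n)
      (fun j => nHat n (M n) (fun i => Xs i ω) (c n) (j + 1)) i :
        EuclideanSpace ℝ (Fin (k - 1)))) atTop
      (fun ω => WithLp.toLp 2 fun i => ξ i ω) (fun _ => P) P₃ := by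
    refine tendstoInDistribution_of_tendstoInMeasure_sub _ _ hclt ?_ hηm
    have h := tendstoInMeasure_comp_of_continuousAt herr
      (continuous_transformedIncr k).continuousAt
    have h0 : (WithLp.toLp 2 fun i => transformedIncr k 1 (fun _ => 0) i :
        EuclideanSpace ℝ (Fin (k - 1))) = 0 := by
      ext i; simp [transformedIncr]
    rw [h0] at h
    refine h.congr_left fun n => Eventually.of_forall fun ω => ?_
    exact (toLp_transformedIncr_sub k (S n) (fun j => nHat n (M n) (fun i => Xs i ω) (c n) (j + 1))
      fun j => countIn (M n) (B n j) fun i => Xs i ω).symm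
  have hmean : TendstoInMeasure P
      (fun n ω => (nHatMean k n (M n) (fun i => Xs i ω) (c n) / S n ^ 2)⁻¹) atTop fun _ => 1 := by
    have hS2 : ∀ n, S n ^ 2 = (M n).card * c n * D := fun n =>
      Real.sq_sqrt (mul_nonneg (mul_nonneg (Nat.cast_nonneg _) (hc_pos n).le) hD.le)
    have hEN : ∀ j : ℕ, Tendsto (fun n => (M n).card * (P₀.map X).real (B n j) / S n ^ 2) atTop
        (𝓝 (1 / (j + 1))) := by
      intro j
      have h := (hp j).div_const D
      have he : D / ((j : ℝ) + 1) / D = 1 / (j + 1) := by field_simp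
      rw [he] at h
      refine h.congr' ?_
      filter_upwards [hm.eventually_gt_atTop 0] with n hn
      have hn' : ((M n).card : ℝ) ≠ 0 := by exact_mod_cast hn.ne'
      have hc' := (hc_pos n).ne'
      rw [hS2]
      field_simp
    -- Chebyshev: the variance is at most m p_j, of order S², and is divided by S⁴.
    have hdev : ∀ j : ℕ, TendstoInMeasure P (fun n ω => (countIn (M n) (B n j) (fun i => Xs i ω) -
        (M n).card * (P₀.map X).real (B n j)) / S n ^ 2) atTop fun _ => 0 := by
      intro j
      rw [tendstoInMeasure_iff_measureReal_norm]
      intro ε hε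
      have hlim : Tendsto (fun n => (M n).card * (P₀.map X).real (B n j) / S n ^ 2 *
          ((1 / ε ^ 2) / S n ^ 2)) atTop (𝓝 0) := by
        have := (hEN j).mul (((tendsto_pow_atTop two_ne_zero).comp hSt).const_div_atTop (1 / ε ^ 2))
        rwa [mul_zero] at this
      refine squeeze_zero' (Eventually.of_forall fun n => measureReal_nonneg) ?_ hlim
      filter_upwards [hSt.eventually_gt_atTop 0] with n hn
      have hpos : 0 < S n ^ 2 := by positivity
      have h := measureReal_le_abs_countIn_sub_le hindep hlaw (M n)
        (measurableSet_exceed (upperLevel (marginDF P₀ X) (1 - c n / (j + 1)))) (mul_pos hε hpos)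
      simp only [sub_zero, Real.norm_eq_abs, abs_div, abs_of_pos hpos, le_div_iff₀ hpos]
      refine h.trans (le_of_eq ?_)
      simp only [hB]
      field_simp
    have hn : ∀ j : ℕ, TendstoInMeasure P
        (fun n ω => nHat n (M n) (fun i => Xs i ω) (c n) (j + 1) / S n ^ 2) atTop
        fun _ => 1 / ((j : ℝ) + 1) := by
      intro j
      -- With N the count at the true level: n̂/S² = (N - E N)/S² + E N/S² + ((n̂ - N)/S)(1/S).
      have h := tendstoInMeasure_comp_of_continuousAt (P := P) (ι := Fin 4)
        (X := ![fun n ω => (countIn (M n) (B n j) (fun i => Xs i ω) -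
          (M n).card * (P₀.map X).real (B n j)) / S n ^ 2,
          fun n _ => (M n).card * (P₀.map X).real (B n j) / S n ^ 2,
          fun n ω => (nHat n (M n) (fun i => Xs i ω) (c n) (j + 1 : ℕ) -
            countIn (M n) (B n j) fun i => Xs i ω) / S n,
          fun n _ => 1 / S n])
        (a := ![0, 1 / ((j : ℝ) + 1), 0, 0]) (by
          intro i
          fin_cases i
          · exact hdev j
          · exact tendstoInMeasure_of_tendsto_const (hEN j)
          · exact herr j
          · exact tendstoInMeasure_of_tendsto_const (hSt.const_div_atTop 1))
        (g := fun v => v 0 + v 1 + v 2 * v 3)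
        (Continuous.continuousAt (by fun_prop))
      simp only [Matrix.cons_val] at h
      rw [zero_add, zero_mul, add_zero] at h
      refine h.congr_left fun n => Eventually.of_forall fun ω => ?_
      simp only
      ring
    have hk' : (k : ℝ) ≠ 0 := by exact_mod_cast hk0.ne'
    have hval : 1 / (k : ℝ) * ∑ j ∈ Finset.range k, ((j : ℝ) + 1) * (1 / (j + 1)) = 1 := by
      have : ∀ j ∈ Finset.range k, ((j : ℝ) + 1) * (1 / (j + 1)) = 1 := fun j _ => by
        have : (j : ℝ) + 1 ≠ 0 := by positivity
        field_simp
      rw [Finset.sum_congr rfl this]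
      simp [hk']
    have h := tendstoInMeasure_comp_of_continuousAt hn
      (g := fun v => (1 / (k : ℝ) * ∑ j ∈ Finset.range k, ((j : ℝ) + 1) * v j)⁻¹)
      (ContinuousAt.inv₀ (Continuous.continuousAt (by fun_prop)) (by rw [hval]; exact one_ne_zero))
    rw [hval, inv_one] at h
    refine h.congr_left fun n => Eventually.of_forall fun ω => ?_
    simp only
    rw [nHatMean_eq_sum_range]
    simp_rw [← mul_div_assoc]
    rw [← Finset.sum_div, ← mul_div_assoc]
  have hfinal := hvec.continuous_comp_prodMk_of_tendstoInMeasure_const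
    (g := fun z : EuclideanSpace ℝ (Fin (k - 1)) × ℝ =>
      (∑ i : Fin (k - 1), limitWeight k (i + 1) * z.1 i ^ 2) * z.2) (by fun_prop) hmean
    fun n => ((measurable_nHatMean hXs k n (M n) (hc_pos n).le).div_const _).inv.aemeasurable
  refine hfinal.congr (fun n => Eventually.of_forall fun ω => ?_)
    (Eventually.of_forall fun ω => by simp)
  -- S vanishes only if `M n` is empty, and then both sides are 0 by the convention for division by
  -- zero.
  rcases eq_or_ne (S n) 0 with h0 | h0
  · have hcard : (M n).card = 0 := by
      by_contra hne
      have h1 : (0 : ℝ) < (M n).card := by exact_mod_cast Nat.pos_of_ne_zero hne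
      exact (Real.sqrt_pos.2 (mul_pos (mul_pos h1 (hc_pos n)) hD)).ne' h0
    have hMe : M n = ∅ := Finset.card_eq_zero.1 hcard
    simp [tHat, nHatMean, nHat, hMe]
  · exact (tHat_eq_sum_transformedIncr hk0 n (M n) (fun i => Xs i ω) (c n) h0).symm
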